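/- Let $(M,g)$ be a smooth Riemannian manifold of dimension $d$ with Levi-Civita connection $\nabla$ and curvature tensor $R(X,Y)Z=\nabla_X\nabla_YZ-\nabla_Y\nabla_XZ-\nabla_{[X,Y]}Z$, and let $p\in M$. Let $\overline{x}=(\overline{x}^1,\dots,\overline{x}^d)$ be normal coordinates centred at $p$, that is, a smooth chart around $p$ sending $p$ to $0$ whose inverse is $y\mapsto\exp_p(\sum_i y^ib_i)$ for an orthonormal basis $(b_i)$ of $T_pM$. Write $\overline{G}$ for the matrix of $g$ in these coordinates, and $\overline{R}_{ijkl}=g\big(R(\overline\partial_i,\overline\partial_j)\overline\partial_l,\overline\partial_k\big)$ for the components of the curvature at $p$ (so that $\overline R_{ijkl}=\frac12(\partial_i\partial_l\overline g_{jk}+\partial_j\partial_k\overline g_{il}-\partial_i\partial_k\overline g_{jl}-\partial_j\partial_l\overline g_{ik})$ at $p$). Repeated indices are summed. Then, as $u\to0$ in $\mathbb{R}^d$, for all indices $m,n$, $$\overline{G}_{mn}(u)=\delta_{mn}+\tfrac13\,\overline{R}_{mkln}\,u^ku^l+o(\|u\|^2).$$ Let moreover $(x^i)$ be any smooth local coordinates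 around $p$, let $x\in\mathbb{R}^d$ be the coordinate vector of $p$ and $G_y$ the matrix of $g$ in these coordinates at the point with coordinates $y$. For $v\in\mathbb{R}^d$ near $0$, let $\overline{v}\in\mathbb{R}^d$ be either the normal coordinates of the point $x+v$, or the components in normal coordinates of the vector $v^i\partial_{x^i}$ tangent at $p$. Then, for each fixed $w\in\mathbb{R}^d$ and either choice of $\overline{v}$, as $v\to0$, $$w^TG_{x+v}w=\frac{\partial\overline{x}^m}{\partial x^i}\frac{\partial\overline{x}^n}{\partial x^j}\Big(\delta_{mn}+\tfrac13\,\overline{R}_{mkln}\,\overline{v}^k\overline{v}^l\Big)w^iw^j+o(\|v\|^2),$$ where the partial derivatives are taken at $x+v$. Equivalently, with $\overline{w}=\big(\frac{\partial\overline{x}^m}{\partial x^i}(x+v)\,w^i\big)_m$, with $R_v=(\overline{R}_{mkln}\overline{v}^k\overline{v}^l)_{m,n}$, and with $\|w\|_{\mathcal X}$ the Riemannian norm, at the point $x+v$, of the tangent vector with components $w$, $$\|w\|_{\mathcal X}^2=\|\overline{w}\|_2^2+\tfrac13\,\overline{w}^TR_v\overline{w}+o(\|v\|^2).$$ -/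

import Mathlib

open Set Bundle Asymptotics Topology
open scoped Manifold ContDiff Matrix

noncomputable section

/-- The coordinate space `ℝⁿ` with its Euclidean norm. -/
abbrev Coord (n : ℕ) : Type := EuclideanSpace ℝ (Fin n)

/-- The partial derivative `∂ᵢ f (y)`. -/
def partialDeriv {n : ℕ} (i : Fin n) (f : Coord n → ℝ) (y : Coord n) : ℝ :=
  fderiv ℝ f y (EuclideanSpace.single i 1)

/-! ### Local expressions attached to the matrix `G` of a metric in a coordinate system -/

/-- Christoffel symbols of the Levi-Civita connection,
`Γᵏᵢⱼ = ½ gᵏˡ (∂ᵢ gⱼₗ + ∂ⱼ gᵢₗ - ∂ₗ gᵢⱼ)`. -/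
def christoffel {n : ℕ} (G : Coord n → Matrix (Fin n) (Fin n) ℝ) (k i j : Fin n)
    (y : Coord n) : ℝ :=
  (1 / 2) * ∑ l, (G y)⁻¹ k l *
    (partialDeriv i (fun z => G z j l) y + partialDeriv j (fun z => G z i l) y
      - partialDeriv l (fun z => G z i j) y)

/-- The components `Rᵢⱼₖˡ = dxˡ(R(∂ᵢ, ∂ⱼ) ∂ₖ)` of the Riemannian curvature tensor
`R(X, Y) Z = ∇_X ∇_Y Z - ∇_Y ∇_X Z - ∇_[X,Y] Z`. -/
def curvature {n : ℕ} (G : Coord n → Matrix (Fin n) (Fin n) ℝ) (i j k l : Fin n)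
    (y : Coord n) : ℝ :=
  partialDeriv i (christoffel G l k j) y - partialDeriv j (christoffel G l k i) y
    + ∑ a, (christoffel G a k j y * christoffel G l a i y
      - christoffel G a k i y * christoffel G l a j y)

/-- The covariant components `Rᵢⱼₖₗ = g(R(∂ᵢ, ∂ⱼ) ∂ₗ, ∂ₖ)`. The contravariant index of
`R(∂ᵢ, ∂ⱼ) ∂ₗ` is lowered into the third place: this is the sign convention for which
`Rᵢⱼₖₗ = ½ (∂ᵢ∂ₗ gⱼₖ + ∂ⱼ∂ₖ gᵢₗ - ∂ᵢ∂ₖ gⱼₗ - ∂ⱼ∂ₗ gᵢₖ)` at a point where the first derivatives of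
the metric vanish. -/
def curvatureCov {n : ℕ} (G : Coord n → Matrix (Fin n) (Fin n) ℝ) (i j k l : Fin n)
    (y : Coord n) : ℝ :=
  ∑ a, G y k a * curvature G i j l a y

/-- The matrix `R_v`, with entries `(R_v)ₘₙ = Rₘₖₗₙ vᵏ vˡ`, the curvature being taken at the origin
of the coordinate system. -/
def curvatureMatrix {n : ℕ} (G : Coord n → Matrix (Fin n) (Fin n) ℝ) (v : Coord n) :
    Matrix (Fin n) (Fin n) ℝ :=
  Matrix.of fun a b => ∑ k, ∑ l, curvatureCov G a k l b 0 * v k * v l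

/-! ### Riemannian manifolds -/

section Manifold

variable {n : ℕ} {M : Type*} [TopologicalSpace M] [ChartedSpace (Coord n) M]

/-- The tangent vector at the point with coordinates `y` in the chart `e` whose components in the
coordinate frame `∂₁, …, ∂ₙ` of `e` are `w`. -/
def ofCoord (e : OpenPartialHomeomorph M (Coord n)) (y w : Coord n) :
    TangentSpace (𝓡 n) (e.symm y) :=
  mfderiv (𝓡 n) (𝓡 n) e.symm y w

/-- The Jacobian matrix `(∂x̄ᵐ/∂xⁱ)ₘᵢ`, at the point with `x`-coordinates `y`, of the change from
the coordinates `x` given by the chart `e` to the coordinates `x̄` given by the chart `φ`. -/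
def jacobian (e φ : OpenPartialHomeomorph M (Coord n)) (y : Coord n) :
    Matrix (Fin n) (Fin n) ℝ :=
  Matrix.of fun m i => partialDeriv i (fun z => φ (e.symm z) m) y

variable [RiemannianBundle (fun x : M => TangentSpace (𝓡 n) x)]

/-- The matrix `gᵢⱼ = g(∂ᵢ, ∂ⱼ)` of the Riemannian metric in the chart `e`, as a function of the
coordinates. -/
def metricMatrix (e : OpenPartialHomeomorph M (Coord n)) (y : Coord n) :
    Matrix (Fin n) (Fin n) ℝ :=
  Matrix.of fun i j =>
    inner ℝ (ofCoord e y (EuclideanSpace.single i 1)) (ofCoord e y (EuclideanSpace.single j 1))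

/-- Geodesics `[0, 1] → M` of the Levi-Civita connection: `C²` paths that satisfy
`γ̈ᵏ + Γᵏᵢⱼ γ̇ⁱ γ̇ʲ = 0` on `(0, 1)` in local coordinates. -/
structure IsGeodesic (γ : ℝ → M) : Prop where
  contMDiffOn : ContMDiffOn 𝓘(ℝ, ℝ) (𝓡 n) 2 γ (Icc 0 1)
  equation : ∀ e ∈ IsManifold.maximalAtlas (𝓡 n) ∞ M, ∀ t ∈ Ioo (0 : ℝ) 1, γ t ∈ e.source →
    ∀ k : Fin n, deriv (deriv fun s => e (γ s) k) t
      + ∑ i, ∑ j, christoffel (metricMatrix e) k i j (e (γ t))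
          * deriv (fun s => e (γ s) i) t * deriv (fun s => e (γ s) j) t = 0

/-- `γ` is a geodesic with `γ(0) = p` and `γ'(0) = v`. -/
def IsGeodesicFrom (p : M) (v : TangentSpace (𝓡 n) p) (γ : ℝ → M) : Prop :=
  IsGeodesic (n := n) γ ∧
    (⟨γ 0, mfderivWithin 𝓘(ℝ, ℝ) (𝓡 n) γ (Icc 0 1) 0 (1 : ℝ)⟩ : TangentBundle (𝓡 n) M) = ⟨p, v⟩

/-- The domain of the exponential map at `p`. -/
def expDomain (p : M) : Set (TangentSpace (𝓡 n) p) :=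
  {v | ∃ γ : ℝ → M, IsGeodesicFrom p v γ}

open Classical in
/-- The exponential map at `p`: `exp_p v = γ(1)`, where `γ` is the geodesic with `γ(0) = p` and
`γ'(0) = v` (and the irrelevant value `p` outside the domain). -/
def expMap (p : M) (v : TangentSpace (𝓡 n) p) : M :=
  if h : ∃ γ : ℝ → M, IsGeodesicFrom p v γ then h.choose 1 else p

/-- `φ` is a system of normal coordinates at `p`: a chart of the smooth manifold `M` around `p`,
centred at `p`, whose inverse is `y ↦ exp_p (y¹ b₁ + ⋯ + yⁿ bₙ)` for some orthonormal basis `b` of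
the tangent space at `p`. -/
structure IsNormalChart (p : M) (φ : OpenPartialHomeomorph M (Coord n)) : Prop where
  mem_maximalAtlas : φ ∈ IsManifold.maximalAtlas (𝓡 n) ∞ M
  mem_source : p ∈ φ.source
  map_center : φ p = 0
  symm_eq_exp : ∃ b : OrthonormalBasis (Fin n) ℝ (TangentSpace (𝓡 n) p), ∀ y ∈ φ.target,
    b.repr.symm y ∈ expDomain p ∧ φ.symm y = expMap p (b.repr.symm y)

end Manifold

end

/-!
In normal coordinates the rays `t ↦ t y` are geodesics: the geodesic `γ` from `p` with initial
velocity `y` satisfies `γ(t) = exp_p(t y)`, because `s ↦ γ(t s)` is the geodesic with initial velocity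
`t y` (`IsNormalChart.exists_radial`). This rests on uniqueness of geodesics
(`IsGeodesicFrom.eqOn`), which is Picard–Lindelöf uniqueness for the first order system in a chart,
continued along `[0, 1]`. It has two consequences for the matrix `G` of the metric in normal
coordinates: the geodesic equation along the rays reads `Γᵏᵢⱼ(u) uⁱ uʲ = 0` near the origin
(`IsNormalChart.christoffel_radial`), and the initial velocities show that `G(0)` is the identity
(`IsNormalChart.metricMatrix_zero`).

The rest of the first claim is calculus in `ℝⁿ` (`metric_taylor_isLittleO`). Restricting to the ray
through `y` and letting `t → 0`, the quadratic form `Γᵏᵢⱼ(0) yⁱ yʲ` and the cubic form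
`∂ₗΓᵏᵢⱼ(0) yⁱ yʲ yˡ` vanish. Polarizing the first gives `Γ(0) = 0`, hence the first derivatives of
`G` vanish at `0`. Polarizing the second gives the vanishing of the cyclic sum of `∂ₗΓᵏᵢⱼ(0)` over
`i, j, l`; written through the second derivatives of `G` this is a linear system that determines
them from the curvature: `Rₘₖₗₙ + Rₘₗₖₙ = 3 ∂ₖ∂ₗ gₘₙ` at the origin
(`curvatureCov_add_curvatureCov_zero`). Taylor's formula of order two concludes.

In arbitrary coordinates, the metric is the pull-back by the Jacobian of the metric in normal
coordinates (`inner_ofCoord_change`). The Jacobian is bounded near `x`, and the normal coordinates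
of `x + v` are `O(‖v‖)` and differ from their linearization by `o(‖v‖)`, so that either reading of
`v̄` changes the quadratic term by `o(‖v‖²)` only (`IsNormalChart.inner_ofCoord_isLittleO`).
-/

/-! ### Second order Taylor expansion in coordinates -/

/-- Taylor's formula of order two at the origin, with the remainder in Peano form: by the mean value
inequality, a function whose derivative is `o(‖u‖)` is itself `o(‖u‖²)`. -/
theorem ContDiffAt.taylor_two_isLittleO {E : Type*} [NormedAddCommGroup E] [NormedSpace ℝ E]
    {f : E → ℝ} (hf : ContDiffAt ℝ 2 f 0) :
    (fun u => f u - (f 0 + fderiv ℝ f 0 u + (1 / 2) * fderiv ℝ (fderiv ℝ f) 0 u u))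
      =o[𝓝 0] fun u => ‖u‖ ^ 2 := by
  have hsymm : IsSymmSndFDerivAt ℝ f 0 := hf.isSymmSndFDerivAt (by simp)
  have hf' : DifferentiableAt ℝ (fderiv ℝ f) 0 :=
    (hf.fderiv_right (m := 1) (by norm_num)).differentiableAt (by norm_num)
  set L := fderiv ℝ (fderiv ℝ f) 0 with hL
  set h : E → ℝ := fun u => f u - (f 0 + fderiv ℝ f 0 u + (1 / 2) * L u u) with hh
  have hder : ∀ᶠ u in 𝓝 (0 : E), HasFDerivAt h (fderiv ℝ f u - fderiv ℝ f 0 - L u) u := by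
    filter_upwards [hf.eventually (by simp)] with u hu
    have h1 : HasFDerivAt f (fderiv ℝ f u) u := (hu.differentiableAt (by norm_num)).hasFDerivAt
    have h2 : HasFDerivAt (fun u => L u u) _ u := (L.hasFDerivAt (x := u)).clm_apply
      (hasFDerivAt_id u)
    have h3 := h1.sub (((fderiv ℝ f 0).hasFDerivAt (x := u)).const_add (f 0) |>.add
      (h2.const_mul (1 / 2)))
    refine h3.congr_fderiv ?_
    ext z
    have : L z u = L u z := hsymm z u
    simp [this]
    ring
  rw [isLittleO_iff]
  intro c hc
  have hlo : (fun u => fderiv ℝ f u - fderiv ℝ f 0 - L u) =o[𝓝 0] fun u => u := by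
    simpa using hf'.hasFDerivAt.isLittleO
  obtain ⟨r, hr, hball⟩ := Metric.eventually_nhds_iff_ball.1
    (hder.and (isLittleO_iff.1 hlo hc))
  filter_upwards [Metric.ball_mem_nhds (0 : E) hr] with u hu
  have hsub : Metric.closedBall (0 : E) ‖u‖ ⊆ Metric.ball 0 r :=
    Metric.closedBall_subset_ball (by simpa using hu)
  have key := (convex_closedBall (0 : E) ‖u‖).norm_image_sub_le_of_norm_hasFDerivWithin_le
    (f := h) (C := c * ‖u‖)
    (fun x hx => (hball x (hsub hx)).1.hasFDerivWithinAt)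
    (fun x hx => (hball x (hsub hx)).2.trans (by
      gcongr; simpa using hx)) (x := 0) (y := u) (by simp) (by simp)
  have h0 : h 0 = 0 := by simp [hh]
  rw [h0] at key
  simp only [sub_zero] at key
  rw [Real.norm_of_nonneg (sq_nonneg ‖u‖), pow_two, ← mul_assoc]
  exact key

section Coordinates

variable {n : ℕ}

theorem Coord.eq_sum_single (u : Coord n) : u = ∑ i, u i • EuclideanSpace.single i (1 : ℝ) := by
  ext j
  simp [Finset.sum_apply, Pi.single_apply]

theorem ContinuousLinearMap.apply_eq_sum_single {F : Type*} [NormedAddCommGroup F] [NormedSpace ℝ F]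
    (L : Coord n →L[ℝ] F) (u : Coord n) :
    L u = ∑ i, u i • L (EuclideanSpace.single i 1) := by
  conv_lhs => rw [Coord.eq_sum_single u]
  simp

theorem contDiffAt_partialDeriv {f : Coord n → ℝ} {y : Coord n} (hf : ContDiffAt ℝ ∞ f y)
    (i : Fin n) : ContDiffAt ℝ ∞ (partialDeriv i f) y :=
  (hf.fderiv_right (m := ∞) le_rfl).clm_apply contDiffAt_const

theorem partialDeriv_partialDeriv {f : Coord n → ℝ} {y : Coord n} (hf : ContDiffAt ℝ ∞ f y)
    (i j : Fin n) : partialDeriv i (partialDeriv j f) y =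
      fderiv ℝ (fderiv ℝ f) y (EuclideanSpace.single i 1) (EuclideanSpace.single j 1) := by
  have h : DifferentiableAt ℝ (fderiv ℝ f) y :=
    (hf.fderiv_right (m := ∞) (by simp)).differentiableAt (by simp)
  have := (h.hasFDerivAt.clm_apply
    (hasFDerivAt_const (EuclideanSpace.single j (1 : ℝ)) y)).fderiv
  simp only [partialDeriv]
  change fderiv ℝ (fun z => fderiv ℝ f z (EuclideanSpace.single j 1)) y _ = _
  rw [this]
  simp

theorem partialDeriv_comm {f : Coord n → ℝ} {y : Coord n} (hf : ContDiffAt ℝ ∞ f y)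
    (i j : Fin n) : partialDeriv i (partialDeriv j f) y = partialDeriv j (partialDeriv i f) y := by
  rw [partialDeriv_partialDeriv hf, partialDeriv_partialDeriv hf]
  exact hf.isSymmSndFDerivAt (by simpa using ENat.LEInfty.out) _ _

theorem ContDiffAt.taylor_two_partialDeriv_isLittleO {f : Coord n → ℝ} (hf : ContDiffAt ℝ ∞ f 0) :
    (fun u : Coord n => f u - (f 0 + ∑ i, partialDeriv i f 0 * u i
        + (1 / 2) * ∑ k, ∑ l, partialDeriv k (partialDeriv l f) 0 * u k * u l))
      =o[𝓝 0] fun u => ‖u‖ ^ 2 := by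
  refine (ContDiffAt.taylor_two_isLittleO (hf.of_le (ENat.LEInfty.out))).congr_left fun u => ?_
  have h1 : fderiv ℝ f 0 u = ∑ i, partialDeriv i f 0 * u i := by
    rw [ContinuousLinearMap.apply_eq_sum_single]
    simp [partialDeriv, mul_comm]
  have h2 : fderiv ℝ (fderiv ℝ f) 0 u u
      = ∑ k, ∑ l, partialDeriv k (partialDeriv l f) 0 * u k * u l := by
    rw [ContinuousLinearMap.apply_eq_sum_single (fderiv ℝ (fderiv ℝ f) 0) u]
    simp only [sum_apply, smul_apply]
    refine Finset.sum_congr rfl fun k _ => ?_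
    rw [ContinuousLinearMap.apply_eq_sum_single, Finset.smul_sum]
    refine Finset.sum_congr rfl fun l _ => ?_
    rw [partialDeriv_partialDeriv hf, smul_eq_mul, smul_eq_mul]
    ring
  rw [h1, h2]

/-! ### Polarization -/

/-- A quadratic form that vanishes identically has no symmetric part. -/
theorem add_eq_zero_of_quadratic_eq_zero {c : Fin n → Fin n → ℝ}
    (h : ∀ y : Fin n → ℝ, ∑ i, ∑ j, c i j * y i * y j = 0) (i j : Fin n) :
    c i j + c j i = 0 := by
  have hi := h (Pi.single i 1)
  have hj := h (Pi.single j 1)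
  have hij := h (Pi.single i 1 + Pi.single j 1)
  simp only [Pi.add_apply, mul_add, Finset.sum_add_distrib, Pi.single_apply, mul_ite,
    mul_one, mul_zero, Finset.sum_ite_eq', Finset.mem_univ, if_true] at hi hj hij
  linarith

/-- A cubic form that vanishes identically has no symmetric part. -/
theorem sum_perm_eq_zero_of_cubic_eq_zero {c : Fin n → Fin n → Fin n → ℝ}
    (h : ∀ y : Fin n → ℝ, ∑ i, ∑ j, ∑ l, c i j l * y i * y j * y l = 0) (i j l : Fin n) :
    c i j l + c i l j + c j i l + c j l i + c l i j + c l j i = 0 := by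
  have h1 := h (Pi.single i 1)
  have h2 := h (Pi.single j 1)
  have h3 := h (Pi.single l 1)
  have h4 := h (Pi.single i 1 + Pi.single j 1)
  have h5 := h (Pi.single i 1 + Pi.single l 1)
  have h6 := h (Pi.single j 1 + Pi.single l 1)
  have h7 := h (Pi.single i 1 + Pi.single j 1 + Pi.single l 1)
  simp only [Pi.add_apply, mul_add, Finset.sum_add_distrib, Pi.single_apply, mul_ite,
    mul_one, mul_zero, Finset.sum_ite_eq', Finset.mem_univ, if_true] at h1 h2 h3 h4 h5 h6 h7
  linarith

/-! ### The metric in coordinates in which straight lines through the origin are geodesics -/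

/-- If `Γᵢⱼ(u) uⁱ uʲ = 0` near the origin, then `Γᵢⱼ(t y) yⁱ yʲ = 0` for fixed `y` and small `t`:
divide by `t²`, and use continuity at `t = 0`. -/
theorem radial_eventually_eq_zero {Γ : Fin n → Fin n → Coord n → ℝ}
    (hc : ∀ i j, ContDiffAt ℝ ∞ (Γ i j) 0)
    (h : ∀ᶠ u : Coord n in 𝓝 0, ∑ i, ∑ j, Γ i j u * u i * u j = 0) (y : Coord n) :
    (fun t : ℝ => ∑ i, ∑ j, Γ i j (t • y) * y i * y j) =ᶠ[𝓝 0] fun _ => 0 := by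
  have hline : Filter.Tendsto (fun t : ℝ => t • y) (𝓝 0) (𝓝 (0 : Coord n)) := by
    have : Continuous (fun t : ℝ => t • y) := by fun_prop
    simpa using this.tendsto 0
  have hne : ∀ᶠ t : ℝ in 𝓝[≠] 0, ∑ i, ∑ j, Γ i j (t • y) * y i * y j = 0 := by
    filter_upwards [(hline.eventually h).filter_mono nhdsWithin_le_nhds,
      self_mem_nhdsWithin] with t ht ht0
    have : t ^ 2 * ∑ i, ∑ j, Γ i j (t • y) * y i * y j = 0 := by
      rw [← ht, Finset.mul_sum]
      refine Finset.sum_congr rfl fun i _ => ?_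
      rw [Finset.mul_sum]
      refine Finset.sum_congr rfl fun j _ => ?_
      simp
      ring
    exact (mul_eq_zero.1 this).resolve_left (pow_ne_zero 2 ht0)
  have hcont : ContinuousAt (fun t : ℝ => ∑ i, ∑ j, Γ i j (t • y) * y i * y j) 0 := by
    refine tendsto_finsetSum _ fun i _ => tendsto_finsetSum _ fun j _ => ?_
    refine Filter.Tendsto.mul_const _ (Filter.Tendsto.mul_const _ ?_)
    rw [zero_smul]
    exact (hc i j).continuousAt.tendsto.comp hline
  have h0 : ∑ i, ∑ j, Γ i j ((0 : ℝ) • y) * y i * y j = 0 :=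
    tendsto_nhds_unique (hcont.tendsto.mono_left nhdsWithin_le_nhds)
      ((tendsto_const_nhds (x := (0 : ℝ))).congr' (hne.mono fun _ h => h.symm))
  rw [Filter.EventuallyEq, ← nhdsNE_sup_pure, Filter.eventually_sup]
  exact ⟨hne, by simpa using h0⟩

/-- The derivative at `t = 0` of the identity `Γᵢⱼ(t y) yⁱ yʲ = 0`. -/
theorem fderiv_radial_eq_zero {Γ : Fin n → Fin n → Coord n → ℝ}
    (hc : ∀ i j, ContDiffAt ℝ ∞ (Γ i j) 0)
    (h : ∀ᶠ u : Coord n in 𝓝 0, ∑ i, ∑ j, Γ i j u * u i * u j = 0) (y : Coord n) :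
    ∑ i, ∑ j, ∑ l, partialDeriv l (Γ i j) 0 * y i * y j * y l = 0 := by
  have hline : HasDerivAt (fun t : ℝ => t • y) y 0 := by
    simpa using (hasDerivAt_id (0 : ℝ)).smul_const y
  have hd : HasDerivAt (fun t : ℝ => ∑ i, ∑ j, Γ i j (t • y) * y i * y j)
      (∑ i, ∑ j, fderiv ℝ (Γ i j) 0 y * y i * y j) 0 := by
    refine HasDerivAt.fun_sum fun i _ => HasDerivAt.fun_sum fun j _ => ?_
    refine ((HasFDerivAt.comp_hasDerivAt (0 : ℝ) ?_ hline).mul_const (y i)).mul_const (y j)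
    rw [zero_smul]
    exact ((hc i j).differentiableAt (by simp)).hasFDerivAt
  have h0 := (radial_eventually_eq_zero hc h y).deriv_eq
  rw [hd.deriv, deriv_const] at h0
  rw [← h0]
  refine Finset.sum_congr rfl fun i _ => Finset.sum_congr rfl fun j _ => ?_
  rw [ContinuousLinearMap.apply_eq_sum_single, Finset.sum_mul, Finset.sum_mul]
  refine Finset.sum_congr rfl fun l _ => ?_
  rw [smul_eq_mul, partialDeriv]
  ring

theorem partialDeriv_mul {f g : Coord n → ℝ} {y : Coord n} (hf : ContDiffAt ℝ ∞ f y)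
    (hg : ContDiffAt ℝ ∞ g y) (i : Fin n) :
    partialDeriv i (fun z => f z * g z) y
      = f y * partialDeriv i g y + g y * partialDeriv i f y := by
  simp only [partialDeriv]
  rw [fderiv_fun_mul (hf.differentiableAt (by simp)) (hg.differentiableAt (by simp))]
  simp

theorem contDiffAt_det {ι E : Type*} [Fintype ι] [DecidableEq ι] [NormedAddCommGroup E]
    [NormedSpace ℝ E] {A : E → Matrix ι ι ℝ} {y : E}
    (hA : ∀ i j, ContDiffAt ℝ ∞ (fun z => A z i j) y) :
    ContDiffAt ℝ ∞ (fun z => (A z).det) y := by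
  simp only [Matrix.det_apply]
  exact ContDiffAt.sum fun σ _ => (contDiffAt_prod fun i _ => hA _ _).const_smul _

theorem contDiffAt_matrix_inv {ι E : Type*} [Fintype ι] [DecidableEq ι] [NormedAddCommGroup E]
    [NormedSpace ℝ E] {A : E → Matrix ι ι ℝ} {y : E}
    (hA : ∀ i j, ContDiffAt ℝ ∞ (fun z => A z i j) y) (hdet : (A y).det ≠ 0) (i j : ι) :
    ContDiffAt ℝ ∞ (fun z => (A z)⁻¹ i j) y := by
  simp only [Matrix.inv_def, Ring.inverse_eq_inv', Matrix.smul_apply, smul_eq_mul,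
    Matrix.adjugate_apply]
  refine ((contDiffAt_det hA).inv hdet).mul (contDiffAt_det fun k l => ?_)
  by_cases hk : k = j
  · subst hk
    simpa using contDiffAt_const
  · simpa [Matrix.updateRow_ne hk] using hA k l

variable {G : Coord n → Matrix (Fin n) (Fin n) ℝ}

theorem contDiffAt_christoffel {y : Coord n} (hG : ∀ i j, ContDiffAt ℝ ∞ (fun z => G z i j) y)
    (hdet : (G y).det ≠ 0) (k i j : Fin n) : ContDiffAt ℝ ∞ (christoffel G k i j) y := by
  refine contDiffAt_const.mul (ContDiffAt.sum fun l _ => (contDiffAt_matrix_inv hG hdet k l).mul ?_)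
  exact ((contDiffAt_partialDeriv (hG _ _) _).add (contDiffAt_partialDeriv (hG _ _) _)).sub
    (contDiffAt_partialDeriv (hG _ _) _)

theorem christoffel_symm (hs : ∀ y i j, G y i j = G y j i) (k i j : Fin n) :
    christoffel G k i j = christoffel G k j i := by
  funext y
  simp only [christoffel]
  congr 1
  refine Finset.sum_congr rfl fun l _ => ?_
  rw [show (fun z => G z i j) = fun z => G z j i from funext fun z => hs z i j]
  ring

theorem christoffel_zero (h1 : G 0 = 1) (k i j : Fin n) :
    christoffel G k i j 0 = (1 / 2) * (partialDeriv i (fun z => G z j k) 0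
      + partialDeriv j (fun z => G z i k) 0 - partialDeriv k (fun z => G z i j) 0) := by
  simp [christoffel, h1, Matrix.one_apply]

/-- At the centre of the coordinates the inverse metric is constant to the order that matters: it is
only ever multiplied by first derivatives of the metric, which vanish there. -/
theorem partialDeriv_christoffel_zero (hG : ∀ i j, ContDiffAt ℝ ∞ (fun z => G z i j) 0)
    (h1 : G 0 = 1) (hd : ∀ l i j, partialDeriv l (fun z => G z i j) 0 = 0) (a k i j : Fin n) :
    partialDeriv a (christoffel G k i j) 0
      = (1 / 2) * (partialDeriv a (partialDeriv i (fun z => G z j k)) 0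
        + partialDeriv a (partialDeriv j (fun z => G z i k)) 0
        - partialDeriv a (partialDeriv k (fun z => G z i j)) 0) := by
  have hD : ∀ l i j, DifferentiableAt ℝ (partialDeriv l (fun z => G z i j)) 0 := fun l i j =>
    (contDiffAt_partialDeriv (hG i j) l).differentiableAt (by simp)
  have hF : ∀ l, ContDiffAt ℝ ∞ (fun y => partialDeriv i (fun z => G z j l) y
      + partialDeriv j (fun z => G z i l) y - partialDeriv l (fun z => G z i j) y) 0 := fun l =>
    ((contDiffAt_partialDeriv (hG _ _) _).add (contDiffAt_partialDeriv (hG _ _) _)).sub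
      (contDiffAt_partialDeriv (hG _ _) _)
  have hI : ∀ l, ContDiffAt ℝ ∞ (fun z => (G z)⁻¹ k l) 0 := fun l =>
    contDiffAt_matrix_inv hG (by simp [h1]) k l
  have hterm : ∀ l, partialDeriv a (fun y => (G y)⁻¹ k l * (partialDeriv i (fun z => G z j l) y
      + partialDeriv j (fun z => G z i l) y - partialDeriv l (fun z => G z i j) y)) 0
      = (1 : Matrix (Fin n) (Fin n) ℝ) k l * (partialDeriv a (partialDeriv i (fun z => G z j l)) 0
        + partialDeriv a (partialDeriv j (fun z => G z i l)) 0
        - partialDeriv a (partialDeriv l (fun z => G z i j)) 0) := by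
    intro l
    rw [partialDeriv_mul (hI l) (hF l), hd, hd, hd, h1, inv_one]
    simp only [add_zero, sub_zero, zero_mul]
    congr 1
    rw [partialDeriv, fderiv_fun_sub ((hD _ _ _).fun_add (hD _ _ _)) (hD _ _ _),
      fderiv_fun_add (hD _ _ _) (hD _ _ _)]
    rfl
  have hsum : partialDeriv a (christoffel G k i j) 0 = (1 / 2) * ∑ l, partialDeriv a
      (fun y => (G y)⁻¹ k l * (partialDeriv i (fun z => G z j l) y
        + partialDeriv j (fun z => G z i l) y - partialDeriv l (fun z => G z i j) y)) 0 := by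
    have hdiff : ∀ l, DifferentiableAt ℝ (fun y => (G y)⁻¹ k l *
        (partialDeriv i (fun z => G z j l) y + partialDeriv j (fun z => G z i l) y
          - partialDeriv l (fun z => G z i j) y)) 0 := fun l =>
      ((hI l).mul (hF l)).differentiableAt (by simp)
    change fderiv ℝ (fun y => (1 / 2) * ∑ l, (G y)⁻¹ k l *
        (partialDeriv i (fun z => G z j l) y + partialDeriv j (fun z => G z i l) y
          - partialDeriv l (fun z => G z i j) y)) 0 _ = _
    rw [fderiv_const_mul (DifferentiableAt.fun_sum fun l _ => hdiff l),
      fderiv_fun_sum fun l _ => hdiff l]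
    simp [partialDeriv]
  rw [hsum, Finset.sum_congr rfl fun l _ => hterm l]
  simp [Matrix.one_apply]

/-- If the straight lines through the origin satisfy the geodesic equation, the first derivatives
of the metric vanish at the origin. -/
theorem partialDeriv_metric_zero (hG : ∀ i j, ContDiffAt ℝ ∞ (fun z => G z i j) 0)
    (hs : ∀ y i j, G y i j = G y j i) (h1 : G 0 = 1)
    (hrad : ∀ k, ∀ᶠ u : Coord n in 𝓝 0, ∑ i, ∑ j, christoffel G k i j u * u i * u j = 0)
    (l i j : Fin n) : partialDeriv l (fun z => G z i j) 0 = 0 := by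
  have hΓ : ∀ k i j, christoffel G k i j 0 = 0 := by
    intro k i j
    have h := add_eq_zero_of_quadratic_eq_zero (c := fun i j => christoffel G k i j 0) (fun y => by
      have := (radial_eventually_eq_zero (fun i j => contDiffAt_christoffel hG (by simp [h1]) k i j)
        (hrad k) (WithLp.toLp 2 y)).eq_of_nhds
      simpa using this) i j
    simp only [christoffel_symm hs k j i] at h
    linarith
  have e1 := hΓ i j l
  have e2 := hΓ j i l
  rw [christoffel_zero h1] at e1 e2
  rw [show (fun z => G z j i) = fun z => G z i j from funext fun z => hs z j i] at e1
  rw [show (fun z => G z l i) = fun z => G z i l from funext fun z => hs z l i] at e1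
  rw [show (fun z => G z l j) = fun z => G z j l from funext fun z => hs z l j] at e2
  linarith

/-- The second derivatives of the metric at the origin are determined by the curvature. With
`A` the array of second derivatives, the derivative of the geodesic equation along the straight
lines says that the cyclic sum of `∂ₗ Γᵏᵢⱼ` vanishes, which makes the sum of `A` over all six ways
of pairing its indices vanish. -/
theorem curvatureCov_add_curvatureCov_zero (hG : ∀ i j, ContDiffAt ℝ ∞ (fun z => G z i j) 0)
    (hs : ∀ y i j, G y i j = G y j i) (h1 : G 0 = 1)
    (hrad : ∀ k, ∀ᶠ u : Coord n in 𝓝 0, ∑ i, ∑ j, christoffel G k i j u * u i * u j = 0)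
    (a b k l : Fin n) :
    curvatureCov G a k l b 0 + curvatureCov G a l k b 0
      = 3 * partialDeriv k (partialDeriv l (fun z => G z a b)) 0 := by
  have hd := partialDeriv_metric_zero hG hs h1 hrad
  have hΓ0 : ∀ k i j, christoffel G k i j 0 = 0 := fun k i j => by
    rw [christoffel_zero h1]; simp [hd]
  have hc := fun k i j => contDiffAt_christoffel hG (by simp [h1]) k i j
  -- `A i j k l` stands for `∂ₖ∂ₗ gᵢⱼ` at the origin; it is symmetric in `i, j` and in `k, l`
  obtain ⟨A, hA⟩ : ∃ A : Fin n → Fin n → Fin n → Fin n → ℝ,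
      ∀ i j k l, partialDeriv k (partialDeriv l (fun z => G z i j)) 0 = A i j k l :=
    ⟨_, fun _ _ _ _ => rfl⟩
  have hA1 : ∀ i j k l, A i j k l = A j i k l := fun i j k l => by
    rw [← hA, ← hA, show (fun z => G z i j) = fun z => G z j i from funext fun z => hs z i j]
  have hA2 : ∀ i j k l, A i j k l = A i j l k := fun i j k l => by
    rw [← hA, ← hA, partialDeriv_comm (hG i j)]
  have hdΓ : ∀ a k i j, partialDeriv a (christoffel G k i j) 0
      = (1 / 2) * (A j k a i + A i k a j - A i j a k) := fun a k i j => by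
    rw [partialDeriv_christoffel_zero hG h1 hd, hA, hA, hA]
  have hR : ∀ i j k l, curvatureCov G i j k l 0
      = (1 / 2) * (A j k i l + A i l j k - A j l i k - A i k j l) := fun i j k l => by
    simp only [curvatureCov, h1, Matrix.one_apply, ite_mul, one_mul, zero_mul, Finset.sum_ite_eq,
      Finset.mem_univ, if_true, curvature, hΓ0, mul_zero, sub_zero, Finset.sum_const_zero, hdΓ]
    rw [hA2 l k i j, hA2 l k j i, hA1 l j, hA1 l i, hA2 l k i j]
    ring
  have hcyc : ∀ k i j l, (A j k l i + A i k l j - A i j l k) + (A l k i j + A j k i l - A j l i k)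
      + (A i k j l + A l k j i - A l i j k) = 0 := fun k i j l => by
    have h := sum_perm_eq_zero_of_cubic_eq_zero
      (c := fun i j l => partialDeriv l (christoffel G k i j) 0) (fun y => by
        simpa using fderiv_radial_eq_zero (hc k) (hrad k) (WithLp.toLp 2 y)) i j l
    simp only [hdΓ] at h
    linarith [hA1 i j l k, hA1 j l i k, hA1 l i j k]
  rw [hR, hR, hA]
  -- the four instances, one for each choice of the index left out of the cyclic sum, add up to the
  -- vanishing of the sum of all six pairings; the rest is linear algebra
  have c1 := hcyc a b k l
  have c2 := hcyc b a k l
  have c3 := hcyc k a b l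
  have c4 := hcyc l a b k
  grind

/-- The local form of the theorem: in coordinates in which the metric is the identity at the origin
and the straight lines through the origin satisfy the geodesic equation, the quadratic part of the
metric is given by the curvature. -/
theorem metric_taylor_isLittleO (hG : ∀ i j, ContDiffAt ℝ ∞ (fun z => G z i j) 0)
    (hs : ∀ y i j, G y i j = G y j i) (h1 : G 0 = 1)
    (hrad : ∀ k, ∀ᶠ u : Coord n in 𝓝 0, ∑ i, ∑ j, christoffel G k i j u * u i * u j = 0)
    (a b : Fin n) :
    (fun u : Coord n => G u a b - ((if a = b then 1 else 0)
        + (1 / 3) * ∑ k, ∑ l, curvatureCov G a k l b 0 * u k * u l)) =o[𝓝 0] fun u => ‖u‖ ^ 2 := by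
  refine (hG a b).taylor_two_partialDeriv_isLittleO.congr_left fun u => ?_
  have hd := partialDeriv_metric_zero hG hs h1 hrad
  have hswap : ∑ k, ∑ l, curvatureCov G a k l b 0 * u k * u l
      = ∑ k, ∑ l, curvatureCov G a l k b 0 * u k * u l := by
    rw [Finset.sum_comm]
    exact Finset.sum_congr rfl fun k _ => Finset.sum_congr rfl fun l _ => by ring
  have hsum : ∑ k, ∑ l, curvatureCov G a k l b 0 * u k * u l
      + ∑ k, ∑ l, curvatureCov G a l k b 0 * u k * u l
      = 3 * ∑ k, ∑ l, partialDeriv k (partialDeriv l (fun z => G z a b)) 0 * u k * u l := by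
    simp only [← Finset.sum_add_distrib, Finset.mul_sum]
    refine Finset.sum_congr rfl fun k _ => Finset.sum_congr rfl fun l _ => ?_
    linear_combination u k * u l * curvatureCov_add_curvatureCov_zero hG hs h1 hrad a b k l
  simp only [hd, h1, Matrix.one_apply, zero_mul, Finset.sum_const_zero, add_zero]
  linarith

end Coordinates

section Charts

variable {n : ℕ} {M : Type*} [TopologicalSpace M] [ChartedSpace (Coord n) M]

/-! ### The metric in a chart -/

theorem tangentBundle_mk_congr {p q : M} (hpq : p = q) {v w : Coord n} (hvw : v = w) :
    (⟨p, v⟩ : TangentBundle (𝓡 n) M) = ⟨q, w⟩ := by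
  subst hpq hvw; rfl

theorem ofCoord_eq_sum (e : OpenPartialHomeomorph M (Coord n)) (y w : Coord n) :
    ofCoord e y w = ∑ i, w i • ofCoord e y (EuclideanSpace.single i 1) := by
  exact ContinuousLinearMap.apply_eq_sum_single (F := Coord n)
    (mfderiv (𝓡 n) (𝓡 n) e.symm y : Coord n →L[ℝ] Coord n) w

theorem ofCoord_smul (e : OpenPartialHomeomorph M (Coord n)) (y w : Coord n) (c : ℝ) :
    ofCoord e y (c • w) = c • ofCoord e y w :=
  map_smul (mfderiv (𝓡 n) (𝓡 n) e.symm y) c w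

theorem jacobian_mulVec {M : Type*} [TopologicalSpace M] {e φ : OpenPartialHomeomorph M (Coord n)} {y : Coord n}
    (h : DifferentiableAt ℝ (fun z => φ (e.symm z)) y) (w : Coord n) :
    WithLp.toLp 2 (jacobian e φ y *ᵥ w) = fderiv ℝ (fun z => φ (e.symm z)) y w := by
  ext m
  have hm : ∀ i, jacobian e φ y m i
      = fderiv ℝ (fun z => φ (e.symm z)) y (EuclideanSpace.single i 1) m := fun i => by
    have := ((EuclideanSpace.proj m : Coord n →L[ℝ] ℝ).hasFDerivAt.comp y h.hasFDerivAt).fderiv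
    simp only [jacobian, Matrix.of_apply, partialDeriv]
    change fderiv ℝ ((EuclideanSpace.proj m : Coord n →L[ℝ] ℝ) ∘ fun z => φ (e.symm z)) y _ = _
    rw [this]
    rfl
  rw [ContinuousLinearMap.apply_eq_sum_single]
  simp [Matrix.mulVec, dotProduct, hm, mul_comm]

theorem contDiffAt_chart_comp_symm {e φ : OpenPartialHomeomorph M (Coord n)}
    (he : e ∈ IsManifold.maximalAtlas (𝓡 n) ∞ M) (hφ : φ ∈ IsManifold.maximalAtlas (𝓡 n) ∞ M)
    {y : Coord n} (hy : y ∈ e.target) (hyφ : e.symm y ∈ φ.source) :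
    ContDiffAt ℝ ∞ (fun z => φ (e.symm z)) y :=
  ((contMDiffAt_of_mem_maximalAtlas hφ hyφ).comp y
    (contMDiffAt_symm_of_mem_maximalAtlas he hy)).contDiffAt

theorem mdifferentiable_of_mem_maximalAtlas {e : OpenPartialHomeomorph M (Coord n)}
    (he : e ∈ IsManifold.maximalAtlas (𝓡 n) ∞ M) : e.MDifferentiable (𝓡 n) (𝓡 n) :=
  ⟨(contMDiffOn_of_mem_maximalAtlas he).mdifferentiableOn (by simp),
    (contMDiffOn_symm_of_mem_maximalAtlas he).mdifferentiableOn (by simp)⟩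

theorem ofCoord_injective [IsManifold (𝓡 n) ∞ M] {e : OpenPartialHomeomorph M (Coord n)}
    (he : e ∈ IsManifold.maximalAtlas (𝓡 n) ∞ M) {y : Coord n} (hy : y ∈ e.target) :
    Function.Injective (ofCoord e y) :=
  (mdifferentiable_of_mem_maximalAtlas he).symm.mfderiv_injective hy

/-- Change of coordinates for tangent vectors. The base points are equal but not definitionally so,
whence an equality in the tangent bundle. -/
theorem ofCoord_change [IsManifold (𝓡 n) ∞ M] {e φ : OpenPartialHomeomorph M (Coord n)}
    (he : e ∈ IsManifold.maximalAtlas (𝓡 n) ∞ M) (hφ : φ ∈ IsManifold.maximalAtlas (𝓡 n) ∞ M)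
    {y : Coord n} (hy : y ∈ e.target) (hyφ : e.symm y ∈ φ.source) (w : Coord n) :
    (⟨e.symm y, ofCoord e y w⟩ : TangentBundle (𝓡 n) M)
      = ⟨φ.symm (φ (e.symm y)),
          ofCoord φ (φ (e.symm y)) (fderiv ℝ (fun z => φ (e.symm z)) y w)⟩ := by
  have hev : (e.symm : Coord n → M) =ᶠ[𝓝 y] φ.symm ∘ fun z => φ (e.symm z) := by
    filter_upwards [(e.symm.continuousAt hy).preimage_mem_nhds (φ.open_source.mem_nhds hyφ)]
      with z hz
    exact (φ.left_inv hz).symm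
  have hψ : MDifferentiableAt (𝓡 n) (𝓡 n) (fun z => φ (e.symm z)) y :=
    ((contDiffAt_chart_comp_symm he hφ hy hyφ).differentiableAt (by simp)).mdifferentiableAt
  refine tangentBundle_mk_congr (φ.left_inv hyφ).symm ?_
  have h1 := hev.mfderiv_eq (I := 𝓡 n) (I' := 𝓡 n)
  rw [mfderiv_comp y ((mdifferentiable_of_mem_maximalAtlas hφ).mdifferentiableAt_symm
    (φ.map_source hyφ)) hψ, mfderiv_eq_fderiv] at h1
  exact DFunLike.congr_fun h1 w

variable [RiemannianBundle (fun x : M => TangentSpace (𝓡 n) x)]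

theorem inner_congr_of_mk_eq {p q : M} {v v' : TangentSpace (𝓡 n) p} {w w' : TangentSpace (𝓡 n) q}
    (h : (⟨p, v⟩ : TangentBundle (𝓡 n) M) = ⟨q, w⟩)
    (h' : (⟨p, v'⟩ : TangentBundle (𝓡 n) M) = ⟨q, w'⟩) : inner ℝ v v' = inner ℝ w w' := by
  cases h; cases h'; rfl

theorem inner_ofCoord (e : OpenPartialHomeomorph M (Coord n)) (y v w : Coord n) :
    inner ℝ (ofCoord e y v) (ofCoord e y w) = ∑ i, ∑ j, metricMatrix e y i j * v i * w j := by
  rw [ofCoord_eq_sum e y v, ofCoord_eq_sum e y w, sum_inner]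
  refine Finset.sum_congr rfl fun i _ => ?_
  rw [inner_sum]
  refine Finset.sum_congr rfl fun j _ => ?_
  rw [real_inner_smul_left, real_inner_smul_right, metricMatrix, Matrix.of_apply]
  ring

theorem metricMatrix_symm (e : OpenPartialHomeomorph M (Coord n)) (y : Coord n) (i j : Fin n) :
    metricMatrix e y i j = metricMatrix e y j i := by
  simp only [metricMatrix, Matrix.of_apply]
  exact real_inner_comm _ _

theorem metricMatrix_det_ne_zero [IsManifold (𝓡 n) ∞ M] {e : OpenPartialHomeomorph M (Coord n)}
    (he : e ∈ IsManifold.maximalAtlas (𝓡 n) ∞ M) {y : Coord n} (hy : y ∈ e.target) :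
    (metricMatrix e y).det ≠ 0 := by
  intro h
  obtain ⟨w, hw0, hw⟩ := Matrix.exists_mulVec_eq_zero_iff.2 h
  have h0 : inner ℝ (ofCoord e y (WithLp.toLp 2 w)) (ofCoord e y (WithLp.toLp 2 w)) = (0 : ℝ) := by
    rw [inner_ofCoord]
    refine Finset.sum_eq_zero fun i _ => ?_
    have hi : ∑ j, metricMatrix e y i j * w j = 0 := congrFun hw i
    calc ∑ j, metricMatrix e y i j * w i * w j = w i * ∑ j, metricMatrix e y i j * w j := by
          rw [Finset.mul_sum]; exact Finset.sum_congr rfl fun j _ => by ring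
      _ = 0 := by rw [hi, mul_zero]
  have h1 : ofCoord e y (WithLp.toLp 2 w) = ofCoord e y 0 := by
    rw [inner_self_eq_zero.1 h0]
    exact (map_zero (mfderiv (𝓡 n) (𝓡 n) e.symm y)).symm
  refine hw0 ?_
  simpa using congrArg (WithLp.ofLp) (ofCoord_injective he hy h1)

theorem contDiffAt_metricMatrix [IsManifold (𝓡 n) ∞ M]
    [IsContMDiffRiemannianBundle (𝓡 n) ∞ (Coord n) (fun x : M => TangentSpace (𝓡 n) x)]
    {e : OpenPartialHomeomorph M (Coord n)} (he : e ∈ IsManifold.maximalAtlas (𝓡 n) ∞ M)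
    {y : Coord n} (hy : y ∈ e.target) (i j : Fin n) :
    ContDiffAt ℝ ∞ (fun z => metricMatrix e z i j) y := by
  have hT : IsManifold (𝓡 n) 1 M := IsManifold.of_le (n := ∞) (by simp)
  have hU : UniqueMDiffOn (𝓡 n) e.target := e.open_target.uniqueMDiffOn
  have hmap := (contMDiffOn_symm_of_mem_maximalAtlas he).contMDiffOn_tangentMapWithin
    (m := ∞) (by simp) hU
  have hsec : ∀ v : Coord n, ContMDiffOn (𝓡 n) ((𝓡 n).prod 𝓘(ℝ, Coord n)) ∞
      (fun z => (⟨e.symm z, ofCoord e z v⟩ : TangentBundle (𝓡 n) M)) e.target := by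
    intro v
    have hv : ContMDiff (𝓡 n) (𝓡 n).tangent ∞
        (fun z : Coord n => (⟨z, v⟩ : TangentBundle (𝓡 n) (Coord n))) :=
      contMDiff_vectorSpace_iff_contDiff.2 contDiff_const
    refine (hmap.comp hv.contMDiffOn (fun z hz => hz)).congr fun z hz => ?_
    refine tangentBundle_mk_congr rfl ?_
    change mfderiv (𝓡 n) (𝓡 n) e.symm z v = mfderivWithin (𝓡 n) (𝓡 n) e.symm e.target z v
    rw [mfderivWithin_of_isOpen e.open_target hz]
  have := ContMDiffOn.inner_bundle (hsec (EuclideanSpace.single i 1))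
    (hsec (EuclideanSpace.single j 1))
  exact (contMDiffOn_iff_contDiffOn.1 this).contDiffAt (e.open_target.mem_nhds hy)

/-- The squared norm of a coordinate vector, computed through another chart. -/
theorem inner_ofCoord_change [IsManifold (𝓡 n) ∞ M] {e φ : OpenPartialHomeomorph M (Coord n)}
    (he : e ∈ IsManifold.maximalAtlas (𝓡 n) ∞ M) (hφ : φ ∈ IsManifold.maximalAtlas (𝓡 n) ∞ M)
    {y : Coord n} (hy : y ∈ e.target) (hyφ : e.symm y ∈ φ.source) (w : Coord n) :
    inner ℝ (ofCoord e y w) (ofCoord e y w)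
      = ∑ a, ∑ b, metricMatrix φ (φ (e.symm y)) a b
          * (jacobian e φ y *ᵥ w) a * (jacobian e φ y *ᵥ w) b := by
  have h := ofCoord_change he hφ hy hyφ w
  rw [inner_congr_of_mk_eq h h, inner_ofCoord, ← jacobian_mulVec
    ((contDiffAt_chart_comp_symm he hφ hy hyφ).differentiableAt (by simp))]

end Charts

/-! ### The geodesic equation as a first order system -/

section GeodesicODE

variable {n : ℕ}

/-- The vector field on `ℝⁿ × ℝⁿ` whose integral curves are the pairs of a solution of the geodesic
equation with Christoffel symbols `Γ` and its velocity. -/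
noncomputable def geodesicField (Γ : Fin n → Fin n → Fin n → Coord n → ℝ) (q : Coord n × Coord n) :
    Coord n × Coord n :=
  (q.2, WithLp.toLp 2 fun k => -∑ i, ∑ j, Γ k i j q.1 * q.2 i * q.2 j)

variable {Γ : Fin n → Fin n → Fin n → Coord n → ℝ}

theorem contDiffAt_geodesicField {q : Coord n × Coord n}
    (hΓ : ∀ k i j, ContDiffAt ℝ ∞ (Γ k i j) q.1) : ContDiffAt ℝ ∞ (geodesicField Γ) q := by
  have hcoord : ∀ i, ContDiffAt ℝ ∞ (fun q : Coord n × Coord n => q.2 i) q := fun i =>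
    (EuclideanSpace.proj i : Coord n →L[ℝ] ℝ).contDiff.contDiffAt.comp q contDiffAt_snd
  refine contDiffAt_snd.prodMk (contDiffAt_euclidean.2 fun k => ?_)
  exact (ContDiffAt.sum fun i _ => ContDiffAt.sum fun j _ =>
    (((hΓ k i j).comp q contDiffAt_fst).mul (hcoord i)).mul (hcoord j)).neg

/-- A `C²` solution of the geodesic equation in the interior of an interval is an integral curve of
the geodesic field up to the end points, by continuity. -/
theorem hasDerivWithinAt_geodesicField {x : ℝ → Coord n} {a b : ℝ} (hab : a < b)
    (hx : ContDiffOn ℝ 2 x (Icc a b))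
    (hΓ : ∀ t ∈ Icc a b, ∀ k i j, ContDiffAt ℝ ∞ (Γ k i j) (x t))
    (heq : ∀ t ∈ Ioo a b, ∀ k, deriv (deriv fun s => x s k) t
      + ∑ i, ∑ j, Γ k i j (x t) * deriv (fun s => x s i) t * deriv (fun s => x s j) t = 0)
    {t : ℝ} (ht : t ∈ Icc a b) :
    HasDerivWithinAt (fun t => (x t, derivWithin x (Icc a b) t))
      (geodesicField Γ (x t, derivWithin x (Icc a b) t)) (Icc a b) t := by
  set ξ := derivWithin x (Icc a b) with hξ
  have hu : UniqueDiffOn ℝ (Icc a b) := uniqueDiffOn_Icc hab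
  have hξ1 : ContDiffOn ℝ 1 ξ (Icc a b) := hx.derivWithin hu (by norm_num)
  have hx' : ∀ s ∈ Icc a b, HasDerivWithinAt x (ξ s) (Icc a b) s := fun s hs =>
    ((hx s hs).differentiableWithinAt (by norm_num)).hasDerivWithinAt
  have hξ' : ∀ s ∈ Icc a b, HasDerivWithinAt ξ (derivWithin ξ (Icc a b) s) (Icc a b) s :=
    fun s hs => ((hξ1 s hs).differentiableWithinAt (by norm_num)).hasDerivWithinAt
  have hproj : ∀ {f : ℝ → Coord n} {f' : Coord n} {s : ℝ} (k : Fin n), HasDerivAt f f' s →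
      HasDerivAt (fun s => f s k) (f' k) s := fun k h =>
    (EuclideanSpace.proj k : Coord n →L[ℝ] ℝ).hasFDerivAt.comp_hasDerivAt _ h
  have hdx : ∀ s ∈ Ioo a b, ∀ k, deriv (fun s => x s k) s = ξ s k := fun s hs k =>
    (hproj k ((hx' s (Ioo_subset_Icc_self hs)).hasDerivAt (Icc_mem_nhds hs.1 hs.2))).deriv
  have hddx : ∀ s ∈ Ioo a b, ∀ k, deriv (deriv fun s => x s k) s = derivWithin ξ (Icc a b) s k := by
    intro s hs k
    have hev : (deriv fun s => x s k) =ᶠ[𝓝 s] fun s => ξ s k := by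
      filter_upwards [Ioo_mem_nhds hs.1 hs.2] with r hr using hdx r hr k
    rw [hev.deriv_eq]
    exact (hproj k ((hξ' s (Ioo_subset_Icc_self hs)).hasDerivAt (Icc_mem_nhds hs.1 hs.2))).deriv
  have hcont : ContinuousOn (fun s => (geodesicField Γ (x s, ξ s)).2) (Icc a b) := by
    intro s hs
    have h1 := (contDiffAt_geodesicField (q := (x s, ξ s)) (hΓ s hs)).continuousAt.snd
    exact ContinuousAt.comp_continuousWithinAt (f := fun s => (x s, ξ s)) h1
      ((hx s hs).continuousWithinAt.prodMk (hξ1 s hs).continuousWithinAt)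
  have hIoo : EqOn (derivWithin ξ (Icc a b)) (fun s => (geodesicField Γ (x s, ξ s)).2)
      (Ioo a b) := by
    intro s hs
    ext k
    have := heq s hs k
    simp only [hddx s hs, hdx s hs] at this
    simp only [geodesicField]
    linarith
  have hIcc : EqOn (derivWithin ξ (Icc a b)) (fun s => (geodesicField Γ (x s, ξ s)).2)
      (Icc a b) := by
    refine hIoo.of_subset_closure (hξ1.continuousOn_derivWithin hu le_rfl) hcont
      Ioo_subset_Icc_self ?_
    rw [closure_Ioo hab.ne]
  have h := (hx' t ht).prodMk (hξ' t ht)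
  rw [hIcc ht] at h
  exact h

/-- Solutions of the geodesic equation with the same initial position and velocity agree for a short
time, because the geodesic field is Lipschitz near the initial condition. -/
theorem exists_eqOn_of_geodesic_equation {x₁ x₂ : ℝ → Coord n} {a b : ℝ} (hab : a < b)
    (hx₁ : ContDiffOn ℝ 2 x₁ (Icc a b)) (hx₂ : ContDiffOn ℝ 2 x₂ (Icc a b))
    (hΓ₁ : ∀ t ∈ Icc a b, ∀ k i j, ContDiffAt ℝ ∞ (Γ k i j) (x₁ t))
    (hΓ₂ : ∀ t ∈ Icc a b, ∀ k i j, ContDiffAt ℝ ∞ (Γ k i j) (x₂ t))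
    (heq₁ : ∀ t ∈ Ioo a b, ∀ k, deriv (deriv fun s => x₁ s k) t
      + ∑ i, ∑ j, Γ k i j (x₁ t) * deriv (fun s => x₁ s i) t * deriv (fun s => x₁ s j) t = 0)
    (heq₂ : ∀ t ∈ Ioo a b, ∀ k, deriv (deriv fun s => x₂ s k) t
      + ∑ i, ∑ j, Γ k i j (x₂ t) * deriv (fun s => x₂ s i) t * deriv (fun s => x₂ s j) t = 0)
    (h0 : x₁ a = x₂ a) (hv : derivWithin x₁ (Icc a b) a = derivWithin x₂ (Icc a b) a) :
    ∃ c ∈ Ioc a b, EqOn x₁ x₂ (Icc a c) := by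
  have ha : a ∈ Icc a b := left_mem_Icc.2 hab.le
  have hd₁ := fun t ht => hasDerivWithinAt_geodesicField hab hx₁ hΓ₁ heq₁ (t := t) ht
  have hd₂ := fun t ht => hasDerivWithinAt_geodesicField hab hx₂ hΓ₂ heq₂ (t := t) ht
  set f₁ : ℝ → Coord n × Coord n := fun t => (x₁ t, derivWithin x₁ (Icc a b) t)
  set f₂ : ℝ → Coord n × Coord n := fun t => (x₂ t, derivWithin x₂ (Icc a b) t)
  have hf0 : f₁ a = f₂ a := Prod.ext h0 hv
  obtain ⟨K, s, hs, hK⟩ := ((contDiffAt_geodesicField (q := f₁ a) (hΓ₁ a ha)).of_le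
    (m := 1) (by simp)).exists_lipschitzOnWith
  have h1 : ∀ᶠ t in 𝓝[≥] a, f₁ t ∈ s := by
    rw [← nhdsWithin_Icc_eq_nhdsGE hab]
    exact (hd₁ a ha).continuousWithinAt.eventually hs
  have h2 : ∀ᶠ t in 𝓝[≥] a, f₂ t ∈ s := by
    rw [← nhdsWithin_Icc_eq_nhdsGE hab]
    exact (hd₂ a ha).continuousWithinAt.eventually (hf0 ▸ hs)
  obtain ⟨c, hc, hcs⟩ := (mem_nhdsGE_iff_exists_mem_Ioc_Ico_subset hab).1 (h1.and h2)
  have hsub : Icc a c ⊆ Icc a b := Icc_subset_Icc_right hc.2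
  have hder : ∀ {f : ℝ → Coord n × Coord n} {f' : Coord n × Coord n} {t}, t ∈ Ico a c →
      HasDerivWithinAt f f' (Icc a b) t → HasDerivWithinAt f f' (Ici t) t := fun ht h =>
    h.mono_of_mem_nhdsWithin (Icc_mem_nhdsGE_of_mem ⟨ht.1, ht.2.trans_le hc.2⟩)
  have := ODE_solution_unique_of_mem_Icc_right (v := fun _ => geodesicField Γ) (s := fun _ => s)
    (K := K) (a := a) (b := c) (fun _ _ => hK)
    (fun t ht => (hd₁ t (hsub ht)).continuousWithinAt.mono hsub)
    (fun t ht => hder ht (hd₁ t (hsub (Ico_subset_Icc_self ht)))) (fun t ht => (hcs ht).1)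
    (fun t ht => (hd₂ t (hsub ht)).continuousWithinAt.mono hsub)
    (fun t ht => hder ht (hd₂ t (hsub (Ico_subset_Icc_self ht)))) (fun t ht => (hcs ht).2) hf0
  exact ⟨c, hc, fun t ht => congrArg Prod.fst (this ht)⟩

end GeodesicODE

/-! ### Uniqueness of geodesics -/

section Geodesic

variable {n : ℕ} {M : Type*} [TopologicalSpace M] [ChartedSpace (Coord n) M]

theorem mfderiv_congr_of_mk_eq (e : M → Coord n) {p q : M} {v : TangentSpace (𝓡 n) p}
    {w : TangentSpace (𝓡 n) q} (h : (⟨p, v⟩ : TangentBundle (𝓡 n) M) = ⟨q, w⟩) :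
    (mfderiv (𝓡 n) (𝓡 n) e p v : Coord n) = mfderiv (𝓡 n) (𝓡 n) e q w := by
  cases h; rfl

theorem smul_congr_of_mk_eq (c : ℝ) {p q : M} {v : TangentSpace (𝓡 n) p}
    {w : TangentSpace (𝓡 n) q} (h : (⟨p, v⟩ : TangentBundle (𝓡 n) M) = ⟨q, w⟩) :
    (⟨p, c • v⟩ : TangentBundle (𝓡 n) M) = ⟨q, c • w⟩ := by
  cases h; rfl

theorem derivWithin_chart_comp [IsManifold (𝓡 n) ∞ M] {e : OpenPartialHomeomorph M (Coord n)}
    (he : e ∈ IsManifold.maximalAtlas (𝓡 n) ∞ M) {γ : ℝ → M} {t : ℝ} (ht : t ∈ Icc (0 : ℝ) 1)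
    (hγ : ContMDiffOn 𝓘(ℝ, ℝ) (𝓡 n) 2 γ (Icc 0 1)) (hts : γ t ∈ e.source) :
    derivWithin (fun s => e (γ s)) (Icc 0 1) t
      = mfderiv (𝓡 n) (𝓡 n) e (γ t) (mfderivWithin 𝓘(ℝ, ℝ) (𝓡 n) γ (Icc 0 1) t (1 : ℝ)) := by
  have hu : UniqueDiffWithinAt ℝ (Icc (0 : ℝ) 1) t := uniqueDiffOn_Icc_zero_one t ht
  have h := mfderiv_comp_mfderivWithin (I := 𝓘(ℝ, ℝ)) (I' := 𝓡 n) (I'' := 𝓡 n) (g := e) t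
    ((mdifferentiable_of_mem_maximalAtlas he).mdifferentiableAt hts)
    ((hγ t ht).mdifferentiableWithinAt (by norm_num)) hu.uniqueMDiffWithinAt
  rw [mfderivWithin_eq_fderivWithin] at h
  exact DFunLike.congr_fun h (1 : ℝ)

variable [RiemannianBundle (fun x : M => TangentSpace (𝓡 n) x)]

theorem IsNormalChart.zero_mem_target {p : M} {φ : OpenPartialHomeomorph M (Coord n)}
    (hφ : IsNormalChart p φ) : (0 : Coord n) ∈ φ.target :=
  hφ.map_center ▸ φ.map_source hφ.mem_source

theorem IsNormalChart.exists_ball {p : M} {φ : OpenPartialHomeomorph M (Coord n)}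
    (hφ : IsNormalChart p φ) :
    ∃ r > 0, ∀ y : Coord n, ‖y‖ < r → ∀ t ∈ Icc (0 : ℝ) 1, t • y ∈ φ.target := by
  obtain ⟨r, hr, hball⟩ := Metric.isOpen_iff.1 φ.open_target 0 hφ.zero_mem_target
  refine ⟨r, hr, fun y hy t ht => hball ?_⟩
  rw [mem_ball_zero_iff, norm_smul, Real.norm_of_nonneg ht.1]
  exact (mul_le_of_le_one_left (norm_nonneg y) ht.2).trans_lt hy

/-- Slowing down a geodesic by a factor `c` multiplies its initial velocity by `c`. -/
theorem IsGeodesicFrom.comp_mul_left {p : M} {v : TangentSpace (𝓡 n) p} {γ : ℝ → M}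
    (h : IsGeodesicFrom p v γ) {c : ℝ} (hc : c ∈ Ioc (0 : ℝ) 1) :
    IsGeodesicFrom p (c • v) (fun t => γ (c * t)) := by
  have hmaps : MapsTo (fun t => c * t) (Icc (0 : ℝ) 1) (Icc 0 1) := fun t ht =>
    ⟨mul_nonneg hc.1.le ht.1, mul_le_one₀ hc.2 ht.1 ht.2⟩
  have hmul : ContMDiff 𝓘(ℝ, ℝ) 𝓘(ℝ, ℝ) 2 (fun t : ℝ => c * t) :=
    (contDiff_const.mul contDiff_id).contMDiff
  refine ⟨⟨h.1.contMDiffOn.comp hmul.contMDiffOn hmaps, fun e he t ht hs k => ?_⟩, ?_⟩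
  · have ht' : c * t ∈ Ioo (0 : ℝ) 1 :=
      ⟨mul_pos hc.1 ht.1, mul_lt_one_of_nonneg_of_lt_one_right hc.2 ht.1.le ht.2⟩
    have hd : ∀ i, (deriv fun s => e (γ (c * s)) i)
        = fun s => c * deriv (fun s => e (γ s) i) (c * s) :=
      fun i => funext fun s => deriv_comp_mul_left c (fun s => e (γ s) i) s
    have hdd : deriv (fun s => c * deriv (fun s => e (γ s) k) (c * s)) t
        = c * (c * deriv (deriv fun s => e (γ s) k) (c * t)) := by
      rw [deriv_const_mul_field, deriv_comp_mul_left, smul_eq_mul]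
    have := h.1.equation e he (c * t) ht' hs k
    simp only [hd, hdd]
    calc _ = c ^ 2 * (deriv (deriv fun s => e (γ s) k) (c * t)
        + ∑ i, ∑ j, christoffel (metricMatrix e) k i j (e (γ (c * t)))
          * deriv (fun s => e (γ s) i) (c * t) * deriv (fun s => e (γ s) j) (c * t)) := by
          rw [mul_add, Finset.mul_sum]
          congr 1
          · ring
          · refine Finset.sum_congr rfl fun i _ => ?_
            rw [Finset.mul_sum]
            exact Finset.sum_congr rfl fun j _ => by ring
      _ = 0 := by rw [this, mul_zero]
  · refine Eq.trans ?_ (smul_congr_of_mk_eq c h.2)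
    refine tangentBundle_mk_congr (by simp) ?_
    have hu : UniqueMDiffWithinAt 𝓘(ℝ, ℝ) (Icc (0 : ℝ) 1) 0 :=
      (uniqueDiffOn_Icc_zero_one 0 (by simp)).uniqueMDiffWithinAt
    have hder := mfderivWithin_comp_of_eq (I := 𝓘(ℝ, ℝ)) (I' := 𝓘(ℝ, ℝ)) (I'' := 𝓡 n) (g := γ)
      (f := fun t : ℝ => c * t) (x := 0) (y := 0) (s := Icc 0 1) (u := Icc 0 1)
      ((h.1.contMDiffOn 0 (by simp)).mdifferentiableWithinAt (by norm_num))
      (hmul.contMDiffAt.mdifferentiableAt (by norm_num)).mdifferentiableWithinAt hmaps hu (by simp)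
    have hlin : fderivWithin ℝ (fun t : ℝ => c * t) (Icc 0 1) 0 1 = c • (1 : ℝ) := by
      have h1 : HasFDerivWithinAt (fun t : ℝ => c * t) _ (Icc 0 1) 0 :=
        ((hasDerivAt_id' (0 : ℝ)).const_mul c).hasFDerivAt.hasFDerivWithinAt
      rw [h1.fderivWithin (uniqueDiffOn_Icc_zero_one 0 (by simp))]
      simp
    rw [mfderivWithin_eq_fderivWithin] at hder
    have h1 : (mfderivWithin 𝓘(ℝ, ℝ) (𝓡 n) (γ ∘ fun t => c * t) (Icc 0 1) 0 (1 : ℝ) : Coord n)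
        = (mfderivWithin 𝓘(ℝ, ℝ) (𝓡 n) γ (Icc 0 1) 0 : ℝ →L[ℝ] Coord n)
          (fderivWithin ℝ (fun t : ℝ => c * t) (Icc 0 1) 0 1) := DFunLike.congr_fun hder (1 : ℝ)
    rw [hlin] at h1
    exact h1.trans
      (map_smul (mfderivWithin 𝓘(ℝ, ℝ) (𝓡 n) γ (Icc 0 1) 0 : ℝ →L[ℝ] Coord n) c (1 : ℝ))

variable [IsManifold (𝓡 n) ∞ M]
  [IsContMDiffRiemannianBundle (𝓡 n) ∞ (Coord n) (fun x : M => TangentSpace (𝓡 n) x)]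

theorem contDiffAt_christoffel_metricMatrix {e : OpenPartialHomeomorph M (Coord n)}
    (he : e ∈ IsManifold.maximalAtlas (𝓡 n) ∞ M) {y : Coord n} (hy : y ∈ e.target)
    (k i j : Fin n) : ContDiffAt ℝ ∞ (christoffel (metricMatrix e) k i j) y :=
  contDiffAt_christoffel (fun i j => contDiffAt_metricMatrix he hy i j)
    (metricMatrix_det_ne_zero he hy) k i j

/-- Geodesics that agree up to a time agree a little longer. At time `0` the velocities have to be
compared separately; later they are one-sided derivatives of the common part. -/
theorem IsGeodesic.exists_eqOn_extend {γ₁ γ₂ : ℝ → M} (h₁ : IsGeodesic (n := n) γ₁)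
    (h₂ : IsGeodesic (n := n) γ₂)
    (h0 : (⟨γ₁ 0, mfderivWithin 𝓘(ℝ, ℝ) (𝓡 n) γ₁ (Icc 0 1) 0 (1 : ℝ)⟩ : TangentBundle (𝓡 n) M)
      = ⟨γ₂ 0, mfderivWithin 𝓘(ℝ, ℝ) (𝓡 n) γ₂ (Icc 0 1) 0 (1 : ℝ)⟩)
    {a : ℝ} (ha : a ∈ Ico (0 : ℝ) 1) (hag : EqOn γ₁ γ₂ (Icc 0 a)) :
    ∃ c ∈ Ioc a 1, EqOn γ₁ γ₂ (Icc a c) := by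
  have ha' : a ∈ Icc (0 : ℝ) 1 := Ico_subset_Icc_self ha
  have haa : γ₁ a = γ₂ a := hag (right_mem_Icc.2 ha.1)
  set e := chartAt (Coord n) (γ₁ a)
  have he : e ∈ IsManifold.maximalAtlas (𝓡 n) ∞ M := IsManifold.chart_mem_maximalAtlas _
  have hs₁ : γ₁ a ∈ e.source := mem_chart_source _ _
  have hs₂ : γ₂ a ∈ e.source := haa ▸ hs₁
  have hsrc : ∀ {γ : ℝ → M}, IsGeodesic (n := n) γ → γ a ∈ e.source →
      ∀ᶠ t in 𝓝[≥] a, γ t ∈ e.source := by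
    intro γ hγ hs
    have h1 : ∀ᶠ t in 𝓝[Icc 0 1] a, γ t ∈ e.source :=
      (hγ.contMDiffOn.continuousOn a ha').eventually (e.open_source.mem_nhds hs)
    refine h1.filter_mono ?_
    rw [← nhdsWithin_Icc_eq_nhdsGE ha.2]
    exact nhdsWithin_mono a (Icc_subset_Icc_left ha.1)
  obtain ⟨b, hb, hbs⟩ := (mem_nhdsGE_iff_exists_mem_Ioc_Ico_subset ha.2).1
    ((hsrc h₁ hs₁).and (hsrc h₂ hs₂))
  -- a smaller end point, so that the closed interval stays in the domain of the chart
  obtain ⟨b', hab', hb'b⟩ := exists_between hb.1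
  have hsub : Icc a b' ⊆ Icc 0 1 := Icc_subset_Icc ha.1 (hb'b.le.trans hb.2)
  have hIco : ∀ t ∈ Icc a b', t ∈ Ico a b := fun t ht => ⟨ht.1, ht.2.trans_lt hb'b⟩
  have hsm : ∀ {γ : ℝ → M}, IsGeodesic (n := n) γ → ∀ t ∈ Icc (0 : ℝ) 1, γ t ∈ e.source →
      ContDiffWithinAt ℝ 2 (fun s => e (γ s)) (Icc 0 1) t := fun hγ t ht hs =>
    (((contMDiffAt_of_mem_maximalAtlas he hs).of_le ENat.LEInfty.out).comp_contMDiffWithinAt t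
      (hγ.contMDiffOn t ht)).contDiffWithinAt
  have hd : ∀ {γ : ℝ → M}, IsGeodesic (n := n) γ → γ a ∈ e.source → HasDerivWithinAt
      (fun s => e (γ s)) (derivWithin (fun s => e (γ s)) (Icc 0 1) a) (Icc 0 1) a := fun hγ hs =>
    ((hsm hγ a ha' hs).differentiableWithinAt (by norm_num)).hasDerivWithinAt
  have hvel : derivWithin (fun s => e (γ₁ s)) (Icc 0 1) a
      = derivWithin (fun s => e (γ₂ s)) (Icc 0 1) a := by
    rcases ha.1.eq_or_lt with rfl | hpos
    · rw [derivWithin_chart_comp he ha' h₁.contMDiffOn hs₁,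
        derivWithin_chart_comp he ha' h₂.contMDiffOn hs₂]
      exact mfderiv_congr_of_mk_eq e h0
    · have hu : UniqueDiffWithinAt ℝ (Icc 0 a) a :=
        uniqueDiffOn_Icc hpos a (right_mem_Icc.2 hpos.le)
      have hsub' : Icc 0 a ⊆ Icc (0 : ℝ) 1 := Icc_subset_Icc_right ha.2.le
      have e₁ := (hd h₁ hs₁).mono hsub'
      have e₂ := ((hd h₂ hs₂).mono hsub').congr (f₁ := fun s => e (γ₁ s))
        (fun t ht => congrArg e (hag ht)) (congrArg e haa)
      exact hu.eq_deriv _ e₁ e₂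
  have hrestr : ∀ {γ : ℝ → M}, IsGeodesic (n := n) γ → γ a ∈ e.source →
      derivWithin (fun s => e (γ s)) (Icc a b') a = derivWithin (fun s => e (γ s)) (Icc 0 1) a :=
    fun hγ hs => ((hd hγ hs).mono hsub).derivWithin
      (uniqueDiffOn_Icc hab' a (left_mem_Icc.2 hab'.le))
  obtain ⟨c, hc, hceq⟩ := exists_eqOn_of_geodesic_equation
    (Γ := christoffel (metricMatrix e)) (x₁ := fun s => e (γ₁ s)) (x₂ := fun s => e (γ₂ s)) hab'
    (fun t ht => (hsm h₁ t (hsub ht) (hbs (hIco t ht)).1).mono hsub)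
    (fun t ht => (hsm h₂ t (hsub ht) (hbs (hIco t ht)).2).mono hsub)
    (fun t ht k i j => contDiffAt_christoffel_metricMatrix he
      (e.map_source (hbs (hIco t ht)).1) k i j)
    (fun t ht k i j => contDiffAt_christoffel_metricMatrix he
      (e.map_source (hbs (hIco t ht)).2) k i j)
    (fun t ht => h₁.equation e he t ⟨ha.1.trans_lt ht.1, ht.2.trans (hb'b.trans_le hb.2)⟩
      (hbs (hIco t (Ioo_subset_Icc_self ht))).1)
    (fun t ht => h₂.equation e he t ⟨ha.1.trans_lt ht.1, ht.2.trans (hb'b.trans_le hb.2)⟩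
      (hbs (hIco t (Ioo_subset_Icc_self ht))).2)
    (congrArg e haa) (by rw [hrestr h₁ hs₁, hrestr h₂ hs₂, hvel])
  refine ⟨c, ⟨hc.1, hc.2.trans (hb'b.le.trans hb.2)⟩, fun t ht => ?_⟩
  have ht' := hbs (hIco t ⟨ht.1, ht.2.trans hc.2⟩)
  exact e.injOn ht'.1 ht'.2 (hceq ht)

/-- Uniqueness of geodesics. The supremum of the times up to which two geodesics agree is attained
because `M` is Hausdorff, and it is `1` because agreement can be extended. -/
theorem IsGeodesicFrom.eqOn [T2Space M] {p : M} {v : TangentSpace (𝓡 n) p} {γ₁ γ₂ : ℝ → M}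
    (h₁ : IsGeodesicFrom p v γ₁) (h₂ : IsGeodesicFrom p v γ₂) : EqOn γ₁ γ₂ (Icc 0 1) := by
  have h0 := h₁.2.trans h₂.2.symm
  have hp : γ₁ 0 = γ₂ 0 := congrArg TotalSpace.proj h0
  set S : Set ℝ := {t | t ∈ Icc (0 : ℝ) 1 ∧ EqOn γ₁ γ₂ (Icc 0 t)} with hS
  have h0S : (0 : ℝ) ∈ S := ⟨by simp, by simpa using hp⟩
  have hbdd : BddAbove S := ⟨1, fun t ht => ht.1.2⟩
  set T := sSup S with hT
  have hT0 : 0 ≤ T := le_csSup hbdd h0S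
  have hT1 : T ≤ 1 := csSup_le ⟨0, h0S⟩ fun t ht => ht.1.2
  have hTeq : EqOn γ₁ γ₂ (Icc 0 T) := by
    rcases hT0.eq_or_lt with h | h
    · rw [← h]; simpa using hp
    · have hIco : EqOn γ₁ γ₂ (Ico 0 T) := fun s hs => by
        obtain ⟨t, ht, hst⟩ := exists_lt_of_lt_csSup ⟨0, h0S⟩ hs.2
        exact ht.2 ⟨hs.1, hst.le⟩
      have hsub : Icc 0 T ⊆ Icc (0 : ℝ) 1 := Icc_subset_Icc_right hT1
      exact hIco.of_subset_closure (h₁.1.contMDiffOn.continuousOn.mono hsub)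
        (h₂.1.contMDiffOn.continuousOn.mono hsub) Ico_subset_Icc_self (closure_Ico h.ne).ge
  rcases hT1.eq_or_lt with h | h
  · rwa [h] at hTeq
  · obtain ⟨c, hc, hceq⟩ := h₁.1.exists_eqOn_extend h₂.1 h0 ⟨hT0, h⟩ hTeq
    have hcS : c ∈ S := ⟨⟨hT0.trans hc.1.le, hc.2⟩, fun t ht => by
      rcases le_total t T with h' | h'
      · exact hTeq ⟨ht.1, h'⟩
      · exact hceq ⟨h', ht.2⟩⟩
    exact absurd (le_csSup hbdd hcS) (not_le.2 hc.1)

/-! ### Radial geodesics in normal coordinates -/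

variable [T2Space M] {p : M} {φ : OpenPartialHomeomorph M (Coord n)}

/-- In normal coordinates the geodesics starting at the centre are straight lines. Uniqueness of
geodesics is used twice: to replace the geodesic chosen in the definition of the exponential map by
any other one, and to identify the geodesic with initial velocity `t v` with the first part of the
one with initial velocity `v`. -/
theorem IsNormalChart.exists_radial (hφ : IsNormalChart p φ) :
    ∃ b : OrthonormalBasis (Fin n) ℝ (TangentSpace (𝓡 n) p), ∀ y : Coord n,
      (∀ t ∈ Icc (0 : ℝ) 1, t • y ∈ φ.target) →
      ∃ γ : ℝ → M, IsGeodesicFrom p (b.repr.symm y) γ ∧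
        ∀ t ∈ Icc (0 : ℝ) 1, γ t = φ.symm (t • y) := by
  obtain ⟨b, hb⟩ := hφ.symm_eq_exp
  refine ⟨b, fun y hy => ?_⟩
  have hy1 : y ∈ φ.target := by simpa using hy 1 (by simp)
  obtain ⟨γ, hγ⟩ := (hb y hy1).1
  refine ⟨γ, hγ, fun t ht => ?_⟩
  rcases ht.1.eq_or_lt with rfl | hpos
  · have h0 : γ 0 = p := congrArg TotalSpace.proj hγ.2
    rw [zero_smul, h0, ← hφ.map_center, φ.left_inv hφ.mem_source]
  · have hty := hb (t • y) (hy t ht)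
    have hsm : IsGeodesicFrom p (b.repr.symm (t • y)) (fun s => γ (t * s)) := by
      rw [map_smul]
      exact hγ.comp_mul_left ⟨hpos, ht.2⟩
    have hex : ∃ γ : ℝ → M, IsGeodesicFrom p (b.repr.symm (t • y)) γ := hty.1
    rw [hty.2, expMap, dif_pos hex]
    simpa using hsm.eqOn hex.choose_spec (x := 1) (by simp)

/-- The geodesic equation along the straight lines through the centre. -/
theorem IsNormalChart.christoffel_radial (hφ : IsNormalChart p φ) (k : Fin n) :
    ∀ᶠ u : Coord n in 𝓝 0,
      ∑ i, ∑ j, christoffel (metricMatrix φ) k i j u * u i * u j = 0 := by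
  obtain ⟨b, hb⟩ := hφ.exists_radial
  obtain ⟨r, hr, hball⟩ := hφ.exists_ball
  filter_upwards [Metric.ball_mem_nhds (0 : Coord n) (half_pos hr)] with u hu
  -- the point `u` is the midpoint of the radial geodesic with initial velocity `2 u`
  have hy : ‖(2 : ℝ) • u‖ < r := by
    rw [norm_smul, Real.norm_of_nonneg zero_le_two]
    linarith [mem_ball_zero_iff.1 hu]
  obtain ⟨γ, hγ, hγeq⟩ := hb _ (hball _ hy)
  have hφγ : ∀ t ∈ Icc (0 : ℝ) 1, φ (γ t) = t • (2 : ℝ) • u := fun t ht => by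
    rw [hγeq t ht, φ.right_inv (hball _ hy t ht)]
  have hd : ∀ i, ∀ t ∈ Ioo (0 : ℝ) 1, deriv (fun s => φ (γ s) i) t = 2 * u i := by
    intro i t ht
    have hev : (fun s => φ (γ s) i) =ᶠ[𝓝 t] fun s => s * (2 * u i) := by
      filter_upwards [Ioo_mem_nhds ht.1 ht.2] with s hs
      rw [hφγ s (Ioo_subset_Icc_self hs)]
      simp
    rw [hev.deriv_eq]
    simp
  have hhalf : (1 / 2 : ℝ) ∈ Ioo (0 : ℝ) 1 := by norm_num
  have hdd : deriv (deriv fun s => φ (γ s) k) (1 / 2) = 0 := by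
    have hev : (deriv fun s => φ (γ s) k) =ᶠ[𝓝 (1 / 2)] fun _ => 2 * u k := by
      filter_upwards [Ioo_mem_nhds hhalf.1 hhalf.2] with s hs using hd k s hs
    rw [hev.deriv_eq, deriv_const]
  have hsrc : γ (1 / 2) ∈ φ.source := by
    rw [hγeq _ (Ioo_subset_Icc_self hhalf)]
    exact φ.map_target (hball _ hy _ (Ioo_subset_Icc_self hhalf))
  have heq := hγ.1.equation φ hφ.mem_maximalAtlas (1 / 2) hhalf hsrc k
  have hu2 : ((1 / 2 : ℝ) • (2 : ℝ) • u) = u := by rw [smul_smul]; norm_num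
  rw [hdd, zero_add, hφγ _ (Ioo_subset_Icc_self hhalf), hu2] at heq
  simp only [hd _ _ hhalf] at heq
  have h4 : (4 : ℝ) * ∑ i, ∑ j, christoffel (metricMatrix φ) k i j u * u i * u j = 0 := by
    rw [← heq, Finset.mul_sum]
    refine Finset.sum_congr rfl fun i _ => ?_
    rw [Finset.mul_sum]
    exact Finset.sum_congr rfl fun j _ => by ring
  linarith

/-- The differential at the origin of the inverse of a normal chart is the isometry given by the
orthonormal basis, because it maps `y` to the initial velocity of a radial geodesic. -/
theorem IsNormalChart.metricMatrix_zero (hφ : IsNormalChart p φ) : metricMatrix φ 0 = 1 := by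
  obtain ⟨b, hb⟩ := hφ.exists_radial
  obtain ⟨r, hr, hball⟩ := hφ.exists_ball
  have hvel : ∀ y : Coord n, ‖y‖ < r →
      (⟨φ.symm 0, ofCoord φ 0 y⟩ : TangentBundle (𝓡 n) M) = ⟨p, b.repr.symm y⟩ := by
    intro y hy
    obtain ⟨γ, hγ, hγeq⟩ := hb y (hball y hy)
    refine Eq.trans ?_ hγ.2
    have h0 : (0 : ℝ) ∈ Icc (0 : ℝ) 1 := by simp
    have hu : UniqueDiffWithinAt ℝ (Icc (0 : ℝ) 1) 0 := uniqueDiffOn_Icc_zero_one 0 h0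
    refine tangentBundle_mk_congr (by rw [hγeq 0 h0, zero_smul]) ?_
    have hlin : HasFDerivWithinAt (fun t : ℝ => t • y) _ (Icc 0 1) 0 :=
      ((hasDerivAt_id' (0 : ℝ)).smul_const y).hasFDerivAt.hasFDerivWithinAt
    have h1 := mfderiv_comp_mfderivWithin_of_eq (I := 𝓘(ℝ, ℝ)) (I' := 𝓡 n) (I'' := 𝓡 n)
      (g := φ.symm) (f := fun t : ℝ => t • y) (x := 0) (y := 0)
      ((mdifferentiable_of_mem_maximalAtlas hφ.mem_maximalAtlas).mdifferentiableAt_symm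
        hφ.zero_mem_target)
      hlin.differentiableWithinAt.mdifferentiableWithinAt hu.uniqueMDiffWithinAt (zero_smul _ _)
    rw [mfderivWithin_eq_fderivWithin, hlin.fderivWithin hu] at h1
    have h2 : mfderivWithin 𝓘(ℝ, ℝ) (𝓡 n) γ (Icc 0 1) 0
        = mfderivWithin 𝓘(ℝ, ℝ) (𝓡 n) (φ.symm ∘ fun t : ℝ => t • y) (Icc 0 1) 0 :=
      mfderivWithin_congr (fun t ht => hγeq t ht) (hγeq 0 h0)
    have h3 := DFunLike.congr_fun (h2.trans h1) (1 : ℝ)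
    refine Eq.trans ?_ h3.symm
    change (mfderiv (𝓡 n) (𝓡 n) φ.symm 0 : Coord n →L[ℝ] Coord n) y
      = (mfderiv (𝓡 n) (𝓡 n) φ.symm 0 : Coord n →L[ℝ] Coord n)
        (ContinuousLinearMap.toSpanSingleton ℝ ((1 : ℝ) • y) 1)
    simp
  have hr2 : ‖r / 2‖ < r := by rw [Real.norm_of_nonneg (half_pos hr).le]; linarith
  have hsmall : ∀ i : Fin n, ‖(r / 2) • EuclideanSpace.single i (1 : ℝ)‖ < r := fun i => by
    rw [norm_smul]; simpa using hr2
  ext i j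
  have h := inner_congr_of_mk_eq (hvel _ (hsmall i)) (hvel _ (hsmall j))
  rw [ofCoord_smul, ofCoord_smul, real_inner_smul_left, real_inner_smul_right,
    LinearIsometryEquiv.inner_map_map, real_inner_smul_left, real_inner_smul_right] at h
  have hne : r / 2 ≠ 0 := (half_pos hr).ne'
  have h' := mul_left_cancel₀ hne (mul_left_cancel₀ hne h)
  rw [metricMatrix, Matrix.of_apply, h', EuclideanSpace.inner_single_left]
  simp [Matrix.one_apply]

end Geodesic

/-! ### Transport of the expansion to arbitrary coordinates -/

theorem isBigO_coord {n : ℕ} {E : Type*} {l : Filter E} {g : E → ℝ} {f : E → Coord n}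
    (hf : f =O[l] g) (i : Fin n) : (fun v => f v i) =O[l] g :=
  (IsBigO.of_norm_le fun v => PiLp.norm_apply_le (f v) i).trans hf.norm_left

/-- A quadratic form takes values that agree to second order at arguments that agree to first
order. -/
theorem quadratic_sub_isLittleO {n : ℕ} {E : Type*} [NormedAddCommGroup E]
    {f g : E → Coord n} (c : Fin n → Fin n → ℝ) (hf : f =O[𝓝 0] fun v => ‖v‖)
    (hg : g =O[𝓝 0] fun v => ‖v‖) (hfg : (fun v => f v - g v) =o[𝓝 0] fun v => ‖v‖) :
    (fun v => ∑ k, ∑ l, c k l * f v k * f v l - ∑ k, ∑ l, c k l * g v k * g v l)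
      =o[𝓝 0] fun v => ‖v‖ ^ 2 := by
  have hd : ∀ i, (fun v => f v i - g v i) =o[𝓝 0] fun v => ‖v‖ := fun i =>
    (IsBigO.of_norm_le fun v => PiLp.norm_apply_le (f v - g v) i).trans_isLittleO hfg.norm_left
  have h : (fun v => ∑ k, ∑ l, c k l * ((f v k - g v k) * f v l + g v k * (f v l - g v l)))
      =o[𝓝 0] fun v => ‖v‖ ^ 2 := by
    refine IsLittleO.fun_sum fun k _ => IsLittleO.fun_sum fun l _ =>
      IsLittleO.const_mul_left ?_ _
    simp only [pow_two]
    exact ((hd k).mul_isBigO (isBigO_coord hf l)).add ((isBigO_coord hg k).mul_isLittleO (hd l))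
  refine h.congr_left fun v => ?_
  simp only [← Finset.sum_sub_distrib]
  exact Finset.sum_congr rfl fun k _ => Finset.sum_congr rfl fun l _ => by ring

theorem sum_mul_mulVec_mul_mulVec {n : ℕ} (Q : Fin n → Fin n → ℝ) (J : Matrix (Fin n) (Fin n) ℝ)
    (w : Fin n → ℝ) : ∑ a, ∑ b, Q a b * (J *ᵥ w) a * (J *ᵥ w) b
      = ∑ i, ∑ j, ∑ a, ∑ b, J a i * J b j * Q a b * w i * w j := by
  have hcomm : ∑ a, ∑ b, ∑ i, ∑ j, J a i * J b j * Q a b * w i * w j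
      = ∑ i, ∑ j, ∑ a, ∑ b, J a i * J b j * Q a b * w i * w j := by
    have := Finset.sum_comm (s := (Finset.univ : Finset (Fin n × Fin n)))
      (t := (Finset.univ : Finset (Fin n × Fin n)))
      (f := fun p q => J p.1 q.1 * J p.2 q.2 * Q p.1 p.2 * w q.1 * w q.2)
    simpa only [Fintype.sum_prod_type] using this
  rw [← hcomm]
  refine Finset.sum_congr rfl fun a _ => Finset.sum_congr rfl fun b _ => ?_
  simp only [Matrix.mulVec, dotProduct]
  rw [mul_assoc, Finset.sum_mul_sum, Finset.mul_sum]
  refine Finset.sum_congr rfl fun i _ => ?_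
  rw [Finset.mul_sum]
  exact Finset.sum_congr rfl fun j _ => by ring

section Transport

variable {n : ℕ} {M : Type*} [TopologicalSpace M] [T2Space M]
  [ChartedSpace (Coord n) M] [IsManifold (𝓡 n) ∞ M]
  [RiemannianBundle (fun x : M => TangentSpace (𝓡 n) x)]
  [IsContMDiffRiemannianBundle (𝓡 n) ∞ (Coord n) (fun x : M => TangentSpace (𝓡 n) x)]
  {p : M} {φ : OpenPartialHomeomorph M (Coord n)}

theorem IsNormalChart.metricMatrix_isLittleO (hφ : IsNormalChart p φ) (a b : Fin n) :
    (fun u : Coord n => metricMatrix φ u a b - ((if a = b then 1 else 0)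
        + (1 / 3) * ∑ k, ∑ l, curvatureCov (metricMatrix φ) a k l b 0 * u k * u l))
      =o[𝓝 0] fun u => ‖u‖ ^ 2 :=
  metric_taylor_isLittleO
    (fun i j => contDiffAt_metricMatrix hφ.mem_maximalAtlas hφ.zero_mem_target i j)
    (metricMatrix_symm φ) hφ.metricMatrix_zero hφ.christoffel_radial a b

/-- The squared norm of the vector with components `w` at the point `x + v`, computed in normal
coordinates with the metric replaced by its expansion. Either reading of `v̄` differs from the
normal coordinates of the point `x + v` by `o(‖v‖)`. -/
theorem IsNormalChart.inner_ofCoord_isLittleO (hφ : IsNormalChart p φ)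
    {e : OpenPartialHomeomorph M (Coord n)} (he : e ∈ IsManifold.maximalAtlas (𝓡 n) ∞ M)
    (hpe : p ∈ e.source) {vbar : Coord n → Coord n}
    (hvbar : (∀ v, vbar v = φ (e.symm (e p + v))) ∨
      (∀ v, vbar v = WithLp.toLp 2 (jacobian e φ (e p) *ᵥ v))) (w : Coord n) :
    (fun v : Coord n => inner ℝ (ofCoord e (e p + v) w) (ofCoord e (e p + v) w)
      - ∑ a, ∑ b, ((if a = b then 1 else 0)
          + (1 / 3) * ∑ k, ∑ l, curvatureCov (metricMatrix φ) a k l b 0 * vbar v k * vbar v l)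
        * (jacobian e φ (e p + v) *ᵥ w) a * (jacobian e φ (e p + v) *ᵥ w) b)
      =o[𝓝 0] fun v => ‖v‖ ^ 2 := by
  have hφm := hφ.mem_maximalAtlas
  have hpt : e p ∈ e.target := e.map_source hpe
  have hps : e.symm (e p) ∈ φ.source := by rw [e.left_inv hpe]; exact hφ.mem_source
  set ψ : Coord n → Coord n := fun z => φ (e.symm z) with hψ
  have hψ0 : ψ (e p) = 0 := by simp only [hψ, e.left_inv hpe, hφ.map_center]
  have hψs : ContDiffAt ℝ ∞ ψ (e p) := contDiffAt_chart_comp_symm he hφm hpt hps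
  have hshift : Filter.Tendsto (fun v : Coord n => e p + v) (𝓝 0) (𝓝 (e p)) := by
    have : Continuous fun v : Coord n => e p + v := by fun_prop
    simpa using this.tendsto 0
  have hnear : ∀ᶠ v : Coord n in 𝓝 0, e p + v ∈ e.target ∧ e.symm (e p + v) ∈ φ.source :=
    hshift.eventually ((e.open_target.mem_nhds hpt |> Filter.eventually_of_mem <| fun _ h => h).and
      ((e.symm.continuousAt hpt).preimage_mem_nhds (φ.open_source.mem_nhds hps)))
  -- the normal coordinates of the point `x + v`, and their linear approximation
  have hlin : (fun v => ψ (e p + v) - fderiv ℝ ψ (e p) v) =o[𝓝 0] fun v => ‖v‖ := by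
    have := hasFDerivAt_iff_isLittleO_nhds_zero.1
      (hψs.differentiableAt (by simp)).hasFDerivAt
    simpa [hψ0] using this.norm_right
  have hL : (fun v => fderiv ℝ ψ (e p) v) =O[𝓝 0] fun v => ‖v‖ :=
    ((fderiv ℝ ψ (e p)).isBigO_id _).norm_right
  have hu : (fun v => ψ (e p + v)) =O[𝓝 0] fun v => ‖v‖ := by
    simpa using hlin.isBigO.add hL
  have hvb : vbar =O[𝓝 0] (fun v => ‖v‖) ∧
      (fun v => ψ (e p + v) - vbar v) =o[𝓝 0] fun v => ‖v‖ := by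
    rcases hvbar with h | h
    · rw [show vbar = fun v => ψ (e p + v) from funext h]
      exact ⟨hu, by simp⟩
    · rw [show vbar = fun v => fderiv ℝ ψ (e p) v from funext fun v => by
        rw [h, jacobian_mulVec (hψs.differentiableAt (by simp))]]
      exact ⟨hL, hlin⟩
  have hcoef : ∀ a b, (fun v => metricMatrix φ (ψ (e p + v)) a b - ((if a = b then 1 else 0)
      + (1 / 3) * ∑ k, ∑ l, curvatureCov (metricMatrix φ) a k l b 0 * vbar v k * vbar v l))
      =o[𝓝 0] fun v => ‖v‖ ^ 2 := by
    intro a b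
    have htend : Filter.Tendsto (fun v => ψ (e p + v)) (𝓝 0) (𝓝 0) := by
      have := hψs.continuousAt.tendsto.comp hshift
      rwa [hψ0] at this
    have h1 := ((hφ.metricMatrix_isLittleO a b).comp_tendsto htend).trans_isBigO
      (hu.norm_left.pow 2)
    have h2 := (quadratic_sub_isLittleO (fun k l => curvatureCov (metricMatrix φ) a k l b 0)
      hu hvb.1 hvb.2).const_mul_left (1 / 3)
    refine (h1.add h2).congr_left fun v => ?_
    simp only [Function.comp_apply]
    ring
  have hJ : ∀ a, (fun v => (jacobian e φ (e p + v) *ᵥ w) a) =O[𝓝 0] fun _ => (1 : ℝ) := by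
    intro a
    have hc : ContinuousAt (fun y => fderiv ℝ ψ y w a) (e p) := by
      have h1 : ContinuousAt (fun y => fderiv ℝ ψ y w) (e p) :=
        ((hψs.fderiv_right (m := ∞) le_rfl).clm_apply contDiffAt_const).continuousAt
      exact (EuclideanSpace.proj a : Coord n →L[ℝ] ℝ).continuous.continuousAt.comp h1
    refine ((hc.tendsto.comp hshift).isBigO_one ℝ).congr' ?_ Filter.EventuallyEq.rfl
    filter_upwards [hnear] with v hv
    rw [Function.comp_apply, ← jacobian_mulVec
      ((contDiffAt_chart_comp_symm he hφm hv.1 hv.2).differentiableAt (by simp))]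
  have hmain : (fun v => ∑ a, ∑ b, (metricMatrix φ (ψ (e p + v)) a b - ((if a = b then 1 else 0)
      + (1 / 3) * ∑ k, ∑ l, curvatureCov (metricMatrix φ) a k l b 0 * vbar v k * vbar v l))
        * (jacobian e φ (e p + v) *ᵥ w) a * (jacobian e φ (e p + v) *ᵥ w) b)
      =o[𝓝 0] fun v => ‖v‖ ^ 2 := by
    refine IsLittleO.fun_sum fun a _ => IsLittleO.fun_sum fun b _ => ?_
    simpa using ((hcoef a b).mul_isBigO (hJ a)).mul_isBigO (hJ b)
  refine hmain.congr' ?_ Filter.EventuallyEq.rfl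
  filter_upwards [hnear] with v hv
  rw [inner_ofCoord_change he hφm hv.1 hv.2]
  simp only [← Finset.sum_sub_distrib]
  exact Finset.sum_congr rfl fun a _ => Finset.sum_congr rfl fun b _ => by ring

end Transport

theorem mainTheorem2 {n : ℕ} {M : Type*} [TopologicalSpace M] [T2Space M]
    [ChartedSpace (Coord n) M] [IsManifold (𝓡 n) ∞ M]
    [RiemannianBundle (fun x : M => TangentSpace (𝓡 n) x)]
    [IsContMDiffRiemannianBundle (𝓡 n) ∞ (Coord n) (fun x : M => TangentSpace (𝓡 n) x)]
    -- a point, with normal coordinates `x̄` (the chart `φ`) at that point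
    (p : M) (φ : OpenPartialHomeomorph M (Coord n)) (hφ : IsNormalChart p φ)
    -- arbitrary local coordinates `x` (the chart `e`) around that point
    (e : OpenPartialHomeomorph M (Coord n)) (he : e ∈ IsManifold.maximalAtlas (𝓡 n) ∞ M)
    (hpe : p ∈ e.source) :
    -- the metric in normal coordinates, as a function of the normal coordinates
    (∀ a b : Fin n,
      (fun u : Coord n => metricMatrix φ u a b
          - ((if a = b then 1 else 0)
            + (1 / 3) * ∑ k, ∑ l, curvatureCov (metricMatrix φ) a k l b 0 * u k * u l))
        =o[𝓝 0] fun u => ‖u‖ ^ 2) ∧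
    -- the metric in the coordinates `x`; here `v̄` may be read as the normal coordinates of the
    -- point `x + v`, or as the components of the vector `v`, tangent at `x`
    (∀ vbar : Coord n → Coord n,
      ((∀ v, vbar v = φ (e.symm (e p + v))) ∨
        (∀ v, vbar v = WithLp.toLp 2 (jacobian e φ (e p) *ᵥ v))) →
      ∀ w : Coord n,
        ((fun v : Coord n => w ⬝ᵥ (metricMatrix e (e p + v) *ᵥ w)
            - ∑ i, ∑ j, ∑ a, ∑ b,
                jacobian e φ (e p + v) a i * jacobian e φ (e p + v) b j
                  * ((if a = b then 1 else 0)
                    + (1 / 3) * ∑ k, ∑ l,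
                        curvatureCov (metricMatrix φ) a k l b 0 * vbar v k * vbar v l)
                  * w i * w j)
          =o[𝓝 0] fun v => ‖v‖ ^ 2) ∧
        ((fun v : Coord n =>
            let wbar : Coord n := WithLp.toLp 2 (jacobian e φ (e p + v) *ᵥ w)
            ‖ofCoord e (e p + v) w‖ ^ 2
              - (‖wbar‖ ^ 2
                + (1 / 3) * (wbar ⬝ᵥ (curvatureMatrix (metricMatrix φ) (vbar v) *ᵥ wbar))))
          =o[𝓝 0] fun v => ‖v‖ ^ 2)) := by
  refine ⟨fun a b => hφ.metricMatrix_isLittleO a b, fun vbar hvbar w => ⟨?_, ?_⟩⟩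
  · refine (hφ.inner_ofCoord_isLittleO he hpe hvbar w).congr_left fun v => ?_
    rw [inner_ofCoord]
    congr 1
    · simp only [dotProduct, Matrix.mulVec, Finset.mul_sum]
      exact Finset.sum_congr rfl fun i _ => Finset.sum_congr rfl fun j _ => by ring
    · exact sum_mul_mulVec_mul_mulVec (fun a b => (if a = b then 1 else 0) + (1 / 3) * ∑ k, ∑ l,
        curvatureCov (metricMatrix φ) a k l b 0 * vbar v k * vbar v l) _ w
  · refine (hφ.inner_ofCoord_isLittleO he hpe hvbar w).congr_left fun v => ?_
    dsimp only
    rw [real_inner_self_eq_norm_sq]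
    congr 1
    generalize jacobian e φ (e p + v) *ᵥ w = z
    rw [EuclideanSpace.real_norm_sq_eq]
    simp only [dotProduct, Matrix.mulVec, curvatureMatrix, Matrix.of_apply, add_mul,
      Finset.sum_add_distrib, Finset.mul_sum]
    congr 1
    · simp [pow_two]
    · refine Finset.sum_congr rfl fun a _ => Finset.sum_congr rfl fun b _ => ?_
      simp only [Finset.sum_mul, Finset.mul_sum]
      exact Finset.sum_congr rfl fun k _ => Finset.sum_congr rfl fun l _ => by ring
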